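/- Let $(X_{ij})_{i,j\ge 1}$ be an infinite table of i.i.d. complex random variables on a probability space with variance $\mathbb{E}|X_{11}|^2-|\mathbb{E}X_{11}|^2=1$, and for $n\ge 1$ let $X=(X_{ij})_{1\le i,j\le n}$. For an $n\times n$ complex matrix $A$ with singular values $s_1(A)\ge\dots\ge s_n(A)\ge 0$ (the eigenvalues of $\sqrt{AA^*}$), let $\nu_A=\frac1n\sum_{k=1}^n\delta_{s_k(A)}$ be its empirical singular value measure. Then for every $z\in\mathbb{C}$ there is a probability measure $\nu_z$ on $[0,\infty)$, depending only on $z$ (in particular, neither on the law of $X_{11}$ nor on the probability space), such that for every such table, almost surely, $\nu_{n^{-1/2}X-zI}\to\nu_z$ weakly (that is, against bounded continuous functions) as $n\to\infty$. -/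

import Mathlib

open MeasureTheory ProbabilityTheory Filter Topology

noncomputable section

/-- The `k`-th singular value of a square complex matrix, `k = 0, …, n - 1`, in decreasing order:
the singular values of the linear map `x ↦ A x` of the Euclidean space `ℂⁿ`. -/
def Matrix.singularValue {n : ℕ} (A : Matrix (Fin n) (Fin n) ℂ) (k : Fin n) : ℝ :=
  (Matrix.toEuclideanLin A).singularValues k

/-- The empirical singular values measure `ν_A = (1/n) ∑ₖ δ_{s_k(A)}`, as a measure on `ℝ`. -/
def singularValueMeasure {n : ℕ} (A : Matrix (Fin n) (Fin n) ℂ) : Measure ℝ :=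
  (n : ENNReal)⁻¹ • ∑ k : Fin n, Measure.dirac (A.singularValue k)

instance singularValueMeasure.isProbabilityMeasure {n : ℕ} [NeZero n]
    (A : Matrix (Fin n) (Fin n) ℂ) : IsProbabilityMeasure (singularValueMeasure A) := by
  constructor
  have h : (n : ENNReal) ≠ 0 := by exact_mod_cast NeZero.ne n
  simp [singularValueMeasure, ENNReal.inv_mul_cancel h (ENNReal.natCast_ne_top n)]

/-- `ν_A` as a probability measure, for `n ≥ 1`. -/
def singularValueProb {n : ℕ} [NeZero n] (A : Matrix (Fin n) (Fin n) ℂ) : ProbabilityMeasure ℝ :=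
  ⟨singularValueMeasure A, inferInstance⟩

/-- `X` is an infinite table of i.i.d. complex random variables with variance `1`, where
`Var Z = E |Z|² - |E Z|²`. -/
structure IsIIDTableVarOne {Ω : Type*} [MeasurableSpace Ω] (P : Measure Ω)
    (X : ℕ → ℕ → Ω → ℂ) : Prop where
  measurable : ∀ i j, Measurable (X i j)
  indep : iIndepFun (fun p : ℕ × ℕ => X p.1 p.2) P
  identDistrib : ∀ i j, IdentDistrib (X i j) (X 0 0) P P
  memLp : MemLp (X 0 0) 2 P
  variance_eq_one : (∫ ω, ‖X 0 0 ω‖ ^ 2 ∂P) - ‖∫ ω, X 0 0 ω ∂P‖ ^ 2 = 1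

/-- The upper left `n × n` corner of the table `X`, at the sample point `ω`. -/
def cornerMatrix {Ω : Type*} (X : ℕ → ℕ → Ω → ℂ) (n : ℕ) (ω : Ω) :
    Matrix (Fin n) (Fin n) ℂ :=
  Matrix.of fun i j => X i j ω

/-- The matrix `n^{-1/2} X - z I` of size `n × n`. -/
def shiftedMatrix {Ω : Type*} (X : ℕ → ℕ → Ω → ℂ) (z : ℂ) (n : ℕ) (ω : Ω) :
    Matrix (Fin n) (Fin n) ℂ :=
  ((Real.sqrt n : ℝ) : ℂ)⁻¹ • cornerMatrix X n ω - z • (1 : Matrix (Fin n) (Fin n) ℂ)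

end

/-! The test functions are `x ↦ (x² + t)⁻¹`. With `η = √t`, the integral of `η / (x² + η²)` against
the empirical singular value measure of `A` is `m = resolventMean η A`, the normalized trace of a
diagonal block of the inverse of `η + [[0, A], [-Aᴴ, 0]]`. This dilation has Hermitian part `η`, so
its inverse `S` exists and has norm at most `1 / η`. Since second moments give tightness, it
suffices that for countably many `η` the mean `m` converges almost surely to a number depending only
on `z` and `η`.

For bounded centred entries `Y` of unit variance, average the row equations of `S` and expand
`E[Y_ij S]` in the single entry `Y_ij` (`norm_integral_entry_mul_resolvent_sub_le`). In the mean and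
up to `O(n^(-1/2))`, this gives the Schwinger–Dyson equations `η m + m² + z w̄ = 1` and `η w + m w =
z m`, where `w` is the normalized trace of the upper right block (`norm_schwingerDyson_le`). Only
`E|Y|²` survives: `E Y²` multiplies a double sum of size `O(n)` instead of `n²`. McDiarmid's
inequality makes `m` concentrate exponentially fast, which factorizes the expected products and, by
Borel–Cantelli, passes from means to almost sure statements. Eliminating `w` leaves `limitEquation z
η m = 1`, whose left side grows with slope at least `η` on `[0, ∞)`; hence the root is unique and
stable (`abs_sub_limitMean_le`).

General entries are truncated, centred and rescaled (`exists_truncation`). As `m` is Lipschitz for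
the normalized Frobenius norm, the law of large numbers over corners controls the error, while the
mean of the entries is a rank one perturbation that disappears in the limit.

By partial fractions, the uniform closure of the span of `1` and the test functions is an algebra,
and it separates the points of `[0, ∞)`; convergence on test functions plus tightness is therefore
weak convergence. The limit law comes from compactness applied to one Rademacher table, and serves
every table because `limitMean` depends on `z` and `η` only. -/

noncomputable section

/-! ### Operator norm estimates and matrices with scalar Hermitian part -/

section OperatorNorm

open scoped Matrix Matrix.Norms.L2Operator

variable {κ : Type*} [Fintype κ] [DecidableEq κ]

/-- The columns of a matrix have Euclidean norm at most the operator norm. -/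
lemma Matrix.sum_sq_norm_col_le (M : Matrix κ κ ℂ) (b : κ) :
    ∑ a, ‖M a b‖ ^ 2 ≤ ‖M‖ ^ 2 := by
  have h := Matrix.l2_opNorm_mulVec M (EuclideanSpace.single b (1 : ℂ))
  simp only [PiLp.norm_single, norm_one, mul_one] at h
  have h2 := pow_le_pow_left₀ (norm_nonneg _) h 2
  rw [EuclideanSpace.norm_sq_eq] at h2
  simpa using h2

/-- The rows of a matrix have Euclidean norm at most the operator norm. -/
lemma Matrix.sum_sq_norm_row_le (M : Matrix κ κ ℂ) (a : κ) :
    ∑ b, ‖M a b‖ ^ 2 ≤ ‖M‖ ^ 2 := by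
  have h := Matrix.sum_sq_norm_col_le Mᴴ a
  rw [Matrix.l2_opNorm_conjTranspose] at h
  simpa using h

lemma Matrix.norm_entry_le (M : Matrix κ κ ℂ) (a b : κ) : ‖M a b‖ ≤ ‖M‖ := by
  have h := Matrix.sum_sq_norm_row_le M a
  have h1 : ‖M a b‖ ^ 2 ≤ ∑ b, ‖M a b‖ ^ 2 :=
    Finset.single_le_sum (f := fun b => ‖M a b‖ ^ 2) (fun _ _ => sq_nonneg _) (Finset.mem_univ b)
  exact (sq_le_sq₀ (norm_nonneg _) (norm_nonneg _)).1 (h1.trans h)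

/-- A bilinear form is bounded by the operator norm of its matrix. -/
lemma Matrix.norm_sum_mul_mul_le (M : Matrix κ κ ℂ) (u v : κ → ℂ) :
    ‖∑ a, ∑ b, u a * M a b * v b‖ ≤
      ‖M‖ * (√(∑ a, ‖u a‖ ^ 2) * √(∑ b, ‖v b‖ ^ 2)) := by
  have h := Matrix.l2_opNorm_mulVec M (WithLp.toLp 2 v)
  have h1 : ∑ a, ∑ b, u a * M a b * v b = ∑ a, u a * (M *ᵥ v) a := by
    simp [Matrix.mulVec, dotProduct, Finset.mul_sum, mul_assoc]
  have h2 : ‖∑ a, u a * (M *ᵥ v) a‖ ≤ ∑ a, ‖u a‖ * ‖(M *ᵥ v) a‖ :=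
    (norm_sum_le _ _).trans (by simp)
  have h3 := Real.sum_mul_le_sqrt_mul_sqrt Finset.univ (fun a => ‖u a‖) (fun a => ‖(M *ᵥ v) a‖)
  simp only [EuclideanSpace.norm_eq] at h
  rw [h1]
  refine h2.trans (h3.trans ?_)
  calc _ ≤ √(∑ a, ‖u a‖ ^ 2) * (‖M‖ * √(∑ b, ‖v b‖ ^ 2)) := by
        gcongr
        simpa using h
    _ = _ := by ring

/-- Frobenius duality, with the Frobenius norm of the second matrix bounded by its operator
norm. -/
lemma Matrix.norm_trace_mul_le (D M : Matrix κ κ ℂ) :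
    ‖(D * M).trace‖ ≤ √(∑ a, ∑ b, ‖D a b‖ ^ 2) * (√(Fintype.card κ) * ‖M‖) := by
  have h1 : (D * M).trace = ∑ p : κ × κ, D p.1 p.2 * M p.2 p.1 := by
    simp [Matrix.trace, Matrix.mul_apply, Fintype.sum_prod_type]
  have h2 := Real.sum_mul_le_sqrt_mul_sqrt Finset.univ (fun p : κ × κ => ‖D p.1 p.2‖)
    (fun p => ‖M p.2 p.1‖)
  have h3 : ∑ p : κ × κ, ‖M p.2 p.1‖ ^ 2 ≤ Fintype.card κ * ‖M‖ ^ 2 := by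
    rw [Fintype.sum_prod_type]
    calc _ ≤ ∑ _x : κ, ‖M‖ ^ 2 := Finset.sum_le_sum fun x _ => Matrix.sum_sq_norm_col_le M x
      _ = _ := by simp
  have h4 : √(∑ p : κ × κ, ‖M p.2 p.1‖ ^ 2) ≤ √(Fintype.card κ) * ‖M‖ := by
    refine (Real.sqrt_le_sqrt h3).trans ?_
    rw [Real.sqrt_mul (by positivity), Real.sqrt_sq (norm_nonneg _)]
  rw [h1]
  refine (norm_sum_le _ _).trans ?_
  simp only [norm_mul]
  refine h2.trans ?_
  rw [Fintype.sum_prod_type]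
  gcongr

variable {η : ℝ} {M : Matrix κ κ ℂ}

/-- A matrix whose Hermitian part is a positive multiple of the identity is invertible. -/
lemma Matrix.isUnit_det_of_add_conjTranspose (hη : 0 < η)
    (hM : M + Mᴴ = (2 * η : ℂ) • (1 : Matrix κ κ ℂ)) : IsUnit M.det := by
  rw [isUnit_iff_ne_zero]
  intro h0
  obtain ⟨v, hv, hMv⟩ := Matrix.exists_mulVec_eq_zero_iff.2 h0
  -- At a kernel vector the form of `M` and its conjugate both vanish, whereas their sum is
  -- `2η‖v‖²`.
  have h1 : star v ⬝ᵥ ((M + Mᴴ) *ᵥ v) = 0 := by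
    rw [Matrix.add_mulVec, dotProduct_add, hMv, Matrix.dotProduct_mulVec, ← Matrix.star_mulVec,
      hMv]
    simp
  rw [hM, Matrix.smul_mulVec, Matrix.one_mulVec, dotProduct_smul, smul_eq_mul] at h1
  rcases mul_eq_zero.1 h1 with h | h
  · have : (η : ℂ) ≠ 0 := by exact_mod_cast hη.ne'
    simp_all
  · refine hv (funext fun a => ?_)
    have h2 : ∑ a, ‖v a‖ ^ 2 = 0 := by
      have h3 : ((∑ a, ‖v a‖ ^ 2 : ℝ) : ℂ) = star v ⬝ᵥ v := by
        simp [dotProduct, Complex.conj_mul']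
      rw [h] at h3
      exact_mod_cast h3
    have h4 := (Finset.sum_eq_zero_iff_of_nonneg fun a _ => sq_nonneg ‖v a‖).1 h2 a
      (Finset.mem_univ a)
    simpa using h4

/-- The Ward identity for such a matrix. -/
lemma Matrix.smul_conjTranspose_inv_mul_inv (hη : 0 < η)
    (hM : M + Mᴴ = (2 * η : ℂ) • (1 : Matrix κ κ ℂ)) :
    (2 * η : ℂ) • ((M⁻¹)ᴴ * M⁻¹) = M⁻¹ + (M⁻¹)ᴴ := by
  have hu := Matrix.isUnit_det_of_add_conjTranspose hη hM
  have hS : M * M⁻¹ = 1 := Matrix.mul_nonsing_inv _ hu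
  have hS' : (M⁻¹)ᴴ * Mᴴ = 1 := by rw [← Matrix.conjTranspose_mul, hS, Matrix.conjTranspose_one]
  calc _ = (M⁻¹)ᴴ * ((2 * η : ℂ) • (1 : Matrix κ κ ℂ)) * M⁻¹ := by
        simp
    _ = (M⁻¹)ᴴ * (M * M⁻¹) + ((M⁻¹)ᴴ * Mᴴ) * M⁻¹ := by
        rw [← hM, Matrix.mul_add, Matrix.add_mul, Matrix.mul_assoc]
    _ = _ := by rw [hS, hS', mul_one, one_mul, add_comm]

/-- The inverse of such a matrix has operator norm at most `1 / η`. -/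
lemma Matrix.norm_inv_le_of_add_conjTranspose (hη : 0 < η)
    (hM : M + Mᴴ = (2 * η : ℂ) • (1 : Matrix κ κ ℂ)) : ‖M⁻¹‖ ≤ 1 / η := by
  have h1 := Matrix.smul_conjTranspose_inv_mul_inv hη hM
  -- The C*-identity turns the Ward identity into `2η‖M⁻¹‖² ≤ 2‖M⁻¹‖`.
  have h2 : ‖(2 * η : ℂ) • ((M⁻¹)ᴴ * M⁻¹)‖ ≤ ‖M⁻¹‖ + ‖M⁻¹‖ := by
    rw [h1]
    refine (norm_add_le _ _).trans ?_
    rw [Matrix.l2_opNorm_conjTranspose]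
  rw [norm_smul, Matrix.l2_opNorm_conjTranspose_mul_self] at h2
  have h3 : ‖(2 * η : ℂ)‖ = 2 * η := by
    rw [norm_mul, Complex.norm_real, Real.norm_of_nonneg hη.le]; simp
  rw [h3] at h2
  rw [le_div_iff₀ hη]
  rcases (norm_nonneg M⁻¹).eq_or_lt with h | h
  · rw [← h]; simp
  · nlinarith

end OperatorNorm

/-! ### The resolvent of the skew-Hermitian dilation and its perturbation theory -/

section SkewResolvent

open scoped Matrix Matrix.Norms.L2Operator

/-- The average of numbers of norm at most `C` has norm at most `C`. -/
lemma norm_inv_card_mul_sum_le {ι : Type*} [Fintype ι] {f : ι → ℂ} {C : ℝ}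
    (hC : 0 ≤ C) (hf : ∀ i, ‖f i‖ ≤ C) :
    ‖(Fintype.card ι : ℂ)⁻¹ * ∑ i, f i‖ ≤ C := by
  have h : ‖∑ i, f i‖ ≤ Fintype.card ι * C :=
    (norm_sum_le _ _).trans ((Finset.sum_le_sum fun i _ => hf i).trans (by simp))
  rw [norm_mul, norm_inv, Complex.norm_natCast]
  rcases (Nat.cast_nonneg (α := ℝ) (Fintype.card ι)).eq_or_lt with h0 | h0
  · rw [← h0]; simpa using hC
  · rw [inv_mul_le_iff₀ h0]; exact h

variable {ι : Type*} [DecidableEq ι]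

/-- The skew-Hermitian dilation of `A`, shifted by `η`. -/
def skewBlock (η : ℝ) (A : Matrix ι ι ℂ) : Matrix (ι ⊕ ι) (ι ⊕ ι) ℂ :=
  Matrix.fromBlocks ((η : ℂ) • 1) A (-Aᴴ) ((η : ℂ) • 1)

lemma skewBlock_conjTranspose {η : ℝ} (A : Matrix ι ι ℂ) :
    (skewBlock η A)ᴴ = Matrix.fromBlocks ((η : ℂ) • 1) (-A) Aᴴ ((η : ℂ) • 1) := by
  simp [skewBlock, Matrix.fromBlocks_conjTranspose]

lemma skewBlock_add_conjTranspose {η : ℝ} (A : Matrix ι ι ℂ) :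
    skewBlock η A + (skewBlock η A)ᴴ = (2 * η : ℂ) • (1 : Matrix (ι ⊕ ι) (ι ⊕ ι) ℂ) := by
  rw [skewBlock_conjTranspose, skewBlock, Matrix.fromBlocks_add, ← Matrix.fromBlocks_one,
    Matrix.fromBlocks_smul, ← add_smul]
  simp [two_mul]

lemma skewBlock_sub {η : ℝ} (A B : Matrix ι ι ℂ) :
    skewBlock η A - skewBlock η B = Matrix.fromBlocks 0 (A - B) (-(A - B)ᴴ) 0 := by
  rw [sub_eq_add_neg, skewBlock, skewBlock, Matrix.fromBlocks_neg, Matrix.fromBlocks_add]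
  simp [sub_eq_add_neg, add_comm]

/-- The block matrix of a single entry. -/
lemma fromBlocks_single (i j : ι) (y : ℂ) :
    (Matrix.fromBlocks 0 (Matrix.single i j y) (-(Matrix.single i j y)ᴴ) 0 :
      Matrix (ι ⊕ ι) (ι ⊕ ι) ℂ) =
      Matrix.single (.inl i) (.inr j) y - Matrix.single (.inr j) (.inl i) (star y) := by
  ext a b
  rcases a with a | a <;> rcases b with b | b <;> simp [Matrix.single_apply]

variable [Fintype ι]

/-- The inverse of `skewBlock η A`. Its diagonal blocks are `η (A Aᴴ + η²)⁻¹` and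
`η (Aᴴ A + η²)⁻¹`. -/
def skewResolvent (η : ℝ) (A : Matrix ι ι ℂ) : Matrix (ι ⊕ ι) (ι ⊕ ι) ℂ :=
  (skewBlock η A)⁻¹

variable {η : ℝ} (A B : Matrix ι ι ℂ)

lemma skewBlock_isUnit_det (hη : 0 < η) : IsUnit (skewBlock η A).det :=
  Matrix.isUnit_det_of_add_conjTranspose hη (skewBlock_add_conjTranspose A)

lemma skewBlock_mul_skewResolvent (hη : 0 < η) : skewBlock η A * skewResolvent η A = 1 :=
  Matrix.mul_nonsing_inv _ (skewBlock_isUnit_det A hη)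

lemma skewResolvent_mul_skewBlock (hη : 0 < η) : skewResolvent η A * skewBlock η A = 1 :=
  Matrix.nonsing_inv_mul _ (skewBlock_isUnit_det A hη)

lemma norm_skewResolvent_le (hη : 0 < η) : ‖skewResolvent η A‖ ≤ 1 / η :=
  Matrix.norm_inv_le_of_add_conjTranspose hη (skewBlock_add_conjTranspose A)

lemma norm_skewResolvent_entry_le (hη : 0 < η) (a b : ι ⊕ ι) : ‖skewResolvent η A a b‖ ≤ 1 / η :=
  (Matrix.norm_entry_le _ a b).trans (norm_skewResolvent_le A hη)

/-- The resolvent identity. -/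
lemma skewResolvent_sub (hη : 0 < η) :
    skewResolvent η A - skewResolvent η B =
      -(skewResolvent η B * (skewBlock η A - skewBlock η B) * skewResolvent η A) := by
  rw [mul_sub, sub_mul, mul_assoc, skewBlock_mul_skewResolvent A hη,
    skewResolvent_mul_skewBlock B hη]
  simp

/-- Conjugation by `diag(1, -1)` maps the resolvent to its adjoint. -/
lemma skewResolvent_conjTranspose :
    (skewResolvent η A)ᴴ = Matrix.fromBlocks 1 0 0 (-1) * skewResolvent η A *
      Matrix.fromBlocks 1 0 0 (-1) := by
  have hJ : (Matrix.fromBlocks 1 0 0 (-1) : Matrix (ι ⊕ ι) (ι ⊕ ι) ℂ)⁻¹ =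
      Matrix.fromBlocks 1 0 0 (-1) :=
    Matrix.inv_eq_left_inv (by simp [Matrix.fromBlocks_multiply, ← Matrix.fromBlocks_one])
  have h : (skewBlock η A)ᴴ = Matrix.fromBlocks 1 0 0 (-1) * skewBlock η A *
      Matrix.fromBlocks 1 0 0 (-1) := by
    rw [skewBlock_conjTranspose, skewBlock]
    simp [Matrix.fromBlocks_multiply]
  rw [skewResolvent, Matrix.conjTranspose_nonsing_inv, h, Matrix.mul_inv_rev, Matrix.mul_inv_rev,
    hJ, mul_assoc]

lemma star_skewResolvent_inl_inl (i j : ι) :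
    star (skewResolvent η A (.inl j) (.inl i)) = skewResolvent η A (.inl i) (.inl j) := by
  have h := congrFun (congrFun (skewResolvent_conjTranspose (η := η) A) (.inl i)) (.inl j)
  rw [Matrix.conjTranspose_apply] at h
  rw [h]
  simp [Matrix.mul_apply, Matrix.one_apply]

/-- Conjugation by `diag(1, -1)` changes the sign of the off-diagonal blocks. Hence the trace of the
lower left block is determined by that of the upper right one, and the Schwinger–Dyson system closes
in two unknowns. -/
lemma star_skewResolvent_inr_inl (i j : ι) :
    star (skewResolvent η A (.inr j) (.inl i)) = -skewResolvent η A (.inl i) (.inr j) := by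
  have h := congrFun (congrFun (skewResolvent_conjTranspose (η := η) A) (.inl i)) (.inr j)
  rw [Matrix.conjTranspose_apply] at h
  rw [h]
  simp [Matrix.mul_apply, Matrix.one_apply]

/-- The rows of the equation `skewBlock * skewResolvent = 1` in the upper half. -/
lemma skewResolvent_row_eq (hη : 0 < η) (i : ι) (c : ι ⊕ ι) :
    η * skewResolvent η A (.inl i) c + ∑ j, A i j * skewResolvent η A (.inr j) c =
      (1 : Matrix (ι ⊕ ι) (ι ⊕ ι) ℂ) (.inl i) c := by
  rw [← skewBlock_mul_skewResolvent A hη, Matrix.mul_apply, Fintype.sum_sum_type]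
  simp [skewBlock, Matrix.one_apply]

/-- The two diagonal blocks of the resolvent have the same trace. -/
lemma sum_skewResolvent_inr_eq (hη : 0 < η) :
    ∑ i, skewResolvent η A (.inr i) (.inr i) = ∑ i, skewResolvent η A (.inl i) (.inl i) := by
  -- `h1` is the trace of the upper left block of `M S = 1`, `h2` that of the lower right block of
  -- `S M = 1`. Both contain the same mixed sum of `A` against the lower left block of `S`.
  have h1 : ∑ i, (η * skewResolvent η A (.inl i) (.inl i) +
      ∑ j, A i j * skewResolvent η A (.inr j) (.inl i)) = ∑ _i : ι, 1 :=
    Finset.sum_congr rfl fun i _ => by rw [skewResolvent_row_eq A hη]; simp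
  have h2 : ∑ j, ((∑ i, skewResolvent η A (.inr j) (.inl i) * A i j) +
      skewResolvent η A (.inr j) (.inr j) * η) = ∑ _i : ι, 1 := by
    refine Finset.sum_congr rfl fun j _ => ?_
    have h := congrFun (congrFun (skewResolvent_mul_skewBlock A hη) (.inr j)) (.inr j)
    rw [Matrix.mul_apply, Fintype.sum_sum_type] at h
    simpa [skewBlock, Matrix.one_apply] using h
  rw [Finset.sum_add_distrib, ← Finset.mul_sum, Finset.sum_comm] at h1
  rw [Finset.sum_add_distrib, ← Finset.sum_mul] at h2
  have h3 : ∑ j, ∑ i, skewResolvent η A (.inr j) (.inl i) * A i j =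
      ∑ j, ∑ i, A i j * skewResolvent η A (.inr j) (.inl i) := by simp_rw [mul_comm]
  have hη' : (η : ℂ) ≠ 0 := by exact_mod_cast hη.ne'
  apply mul_left_cancel₀ hη'
  linear_combination h2 - h1 - h3


/-- The normalized trace of either diagonal block of `skewResolvent η A`. -/
def resolventMean (η : ℝ) (A : Matrix ι ι ℂ) : ℝ :=
  (Fintype.card ι : ℝ)⁻¹ * ∑ i, (skewResolvent η A (.inl i) (.inl i)).re

lemma skewResolvent_inl_self (i : ι) :
    (((skewResolvent η A (.inl i) (.inl i)).re : ℝ) : ℂ) = skewResolvent η A (.inl i) (.inl i) :=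
  Complex.conj_eq_iff_re.1 (star_skewResolvent_inl_inl A i i)

lemma ofReal_resolventMean :
    (resolventMean η A : ℂ) =
      (Fintype.card ι : ℂ)⁻¹ * ∑ i, skewResolvent η A (.inl i) (.inl i) := by
  simp [resolventMean, skewResolvent_inl_self]

lemma ofReal_resolventMean_eq_inr (hη : 0 < η) :
    (resolventMean η A : ℂ) =
      (Fintype.card ι : ℂ)⁻¹ * ∑ i, skewResolvent η A (.inr i) (.inr i) := by
  rw [ofReal_resolventMean, sum_skewResolvent_inr_eq A hη]

lemma abs_resolventMean_le (hη : 0 < η) : |resolventMean η A| ≤ 1 / η := by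
  rw [← Real.norm_eq_abs, ← Complex.norm_real, ofReal_resolventMean]
  exact norm_inv_card_mul_sum_le (by positivity) fun i => norm_skewResolvent_entry_le A hη _ _

/-- By the Ward identity the real part of a diagonal entry is `η` times the squared norm of its
column. The sign is needed because `limitEquation` is controlled only on `[0, ∞)`. -/
lemma resolventMean_nonneg (hη : 0 < η) : 0 ≤ resolventMean η A := by
  refine mul_nonneg (by positivity) (Finset.sum_nonneg fun i _ => ?_)
  have h := congrFun (congrFun (Matrix.smul_conjTranspose_inv_mul_inv hη
    (skewBlock_add_conjTranspose A)) (.inl i)) (.inl i)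
  change _ = skewResolvent η A (.inl i) (.inl i) + star (skewResolvent η A (.inl i) (.inl i)) at h
  rw [star_skewResolvent_inl_inl, Matrix.smul_apply, Matrix.mul_apply] at h
  have h2 : ∑ a, (skewBlock η A)⁻¹ᴴ (.inl i) a * (skewBlock η A)⁻¹ a (.inl i) =
      ((∑ a, ‖skewResolvent η A a (.inl i)‖ ^ 2 : ℝ) : ℂ) := by
    simp [Complex.conj_mul', skewResolvent]
  rw [h2] at h
  have h3 := congrArg Complex.re h
  rw [smul_eq_mul, show (2 * (η : ℂ)) = ((2 * η : ℝ) : ℂ) by push_cast; ring,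
    ← Complex.ofReal_mul, Complex.ofReal_re, Complex.add_re] at h3
  have h4 : 0 ≤ 2 * η * ∑ a, ‖skewResolvent η A a (.inl i)‖ ^ 2 := by positivity
  linarith

lemma trace_skewResolvent [Nonempty ι] (hη : 0 < η) :
    (skewResolvent η A).trace = 2 * Fintype.card ι * (resolventMean η A : ℂ) := by
  have h : (Fintype.card ι : ℂ) ≠ 0 := by exact_mod_cast Fintype.card_ne_zero
  rw [Matrix.trace, Fintype.sum_sum_type]
  simp only [Matrix.diag_apply]
  rw [sum_skewResolvent_inr_eq A hη, ofReal_resolventMean]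
  field_simp
  ring

lemma norm_skewResolvent_mul_le (hη : 0 < η) :
    ‖skewResolvent η A * skewResolvent η B‖ ≤ 1 / η ^ 2 := by
  refine (norm_mul_le _ _).trans ?_
  calc _ ≤ (1 / η) * (1 / η) := by
        gcongr <;> exact norm_skewResolvent_le _ hη
    _ = _ := by field_simp

/-- Resolvent identity and cyclicity of the trace. All comparisons of means pair the perturbation
with the product of the two resolvents, of norm at most `1 / η²`; they differ only in how this
pairing is estimated. -/
lemma two_card_mul_resolventMean_sub [Nonempty ι] (hη : 0 < η) :
    2 * Fintype.card ι * ((resolventMean η A : ℂ) - resolventMean η B) =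
      -((Matrix.fromBlocks 0 (A - B) (-(A - B)ᴴ) 0 : Matrix (ι ⊕ ι) (ι ⊕ ι) ℂ) *
        (skewResolvent η A * skewResolvent η B)).trace := by
  rw [mul_sub, ← trace_skewResolvent A hη, ← trace_skewResolvent B hη, ← Matrix.trace_sub,
    skewResolvent_sub A B hη, Matrix.trace_neg, skewBlock_sub, mul_assoc, Matrix.trace_mul_comm,
    mul_assoc]

lemma abs_resolventMean_sub_le_of_norm_trace_le [Nonempty ι] (hη : 0 < η) {C : ℝ}
    (h : ‖((Matrix.fromBlocks 0 (A - B) (-(A - B)ᴴ) 0 : Matrix (ι ⊕ ι) (ι ⊕ ι) ℂ) *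
        (skewResolvent η A * skewResolvent η B)).trace‖ ≤ 2 * C) :
    |resolventMean η A - resolventMean η B| ≤ C / Fintype.card ι := by
  have hc : (0 : ℝ) < Fintype.card ι := by exact_mod_cast Fintype.card_pos
  have h1 := congrArg norm (two_card_mul_resolventMean_sub A B hη)
  rw [norm_neg, ← Complex.ofReal_sub, norm_mul, norm_mul, Complex.norm_real, Complex.norm_natCast,
    Real.norm_eq_abs, Complex.norm_ofNat] at h1
  rw [le_div_iff₀ hc]
  linarith

/-- The normalized resolvent trace is Lipschitz for the normalized Frobenius norm. -/
lemma abs_resolventMean_sub_le_frobenius [Nonempty ι] (hη : 0 < η) :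
    |resolventMean η A - resolventMean η B| ≤
      1 / η ^ 2 * √((∑ i, ∑ j, ‖A i j - B i j‖ ^ 2) / Fintype.card ι) := by
  have hc : (0 : ℝ) < Fintype.card ι := by exact_mod_cast Fintype.card_pos
  set F := ∑ i, ∑ j, ‖A i j - B i j‖ ^ 2 with hF
  have hF0 : 0 ≤ F := by positivity
  have h := Matrix.norm_trace_mul_le
    (Matrix.fromBlocks 0 (A - B) (-(A - B)ᴴ) 0 : Matrix (ι ⊕ ι) (ι ⊕ ι) ℂ)
    (skewResolvent η A * skewResolvent η B)
  -- The perturbation occurs in both off-diagonal blocks, whence the factor `2`, which cancels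
  -- against the `2 * card ι` of the trace formula.
  have h2 : ∑ a, ∑ b, ‖(Matrix.fromBlocks 0 (A - B) (-(A - B)ᴴ) 0 :
      Matrix (ι ⊕ ι) (ι ⊕ ι) ℂ) a b‖ ^ 2 = 2 * F := by
    simp only [Fintype.sum_sum_type]
    simp only [Matrix.fromBlocks_apply₁₁, Matrix.fromBlocks_apply₁₂, Matrix.fromBlocks_apply₂₁,
      Matrix.fromBlocks_apply₂₂, Matrix.zero_apply, Matrix.neg_apply, Matrix.conjTranspose_apply,
      norm_neg, norm_star, norm_zero, Matrix.sub_apply]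
    have h3 : ∑ x, ∑ y, ‖A y x - B y x‖ ^ 2 = F := Finset.sum_comm
    simp [two_mul, ← hF, h3]
  rw [h2] at h
  have h3 : √(2 * F) * (√(Fintype.card (ι ⊕ ι)) * ‖skewResolvent η A * skewResolvent η B‖) ≤
      2 * (1 / η ^ 2 * √(F * Fintype.card ι)) := by
    calc _ ≤ √(2 * F) * (√(Fintype.card (ι ⊕ ι)) * (1 / η ^ 2)) := by
          gcongr; exact norm_skewResolvent_mul_le A B hη
      _ = 1 / η ^ 2 * √(2 * F * Fintype.card (ι ⊕ ι)) := by
          rw [Real.sqrt_mul (by positivity : 0 ≤ 2 * F)]; ring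
      _ = _ := by
          rw [Fintype.card_sum]
          push_cast
          rw [show 2 * F * ((Fintype.card ι : ℝ) + Fintype.card ι) =
            2 ^ 2 * (F * Fintype.card ι) by ring, Real.sqrt_mul (by positivity),
            Real.sqrt_sq (by positivity)]
          ring
  refine (abs_resolventMean_sub_le_of_norm_trace_le A B hη (h.trans h3)).trans (le_of_eq ?_)
  rw [mul_div_assoc]
  congr 1
  rw [Real.sqrt_mul hF0, Real.sqrt_div hF0, mul_div_assoc, Real.sqrt_div_self', one_div,
    div_eq_mul_inv]

/-- Adding a constant to all entries is a rank one perturbation. -/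
lemma abs_resolventMean_sub_le_of_sub_const [Nonempty ι] (hη : 0 < η) {c : ℂ}
    (h : ∀ i j, A i j - B i j = c) :
    |resolventMean η A - resolventMean η B| ≤ ‖c‖ / η ^ 2 := by
  have hc : (0 : ℝ) < Fintype.card ι := by exact_mod_cast Fintype.card_pos
  set M := skewResolvent η A * skewResolvent η B with hM
  -- Pairing with a constant matrix only sees sums over whole off-diagonal blocks, that is, the
  -- bilinear form of `M` at the indicators of the two halves. This gains over the Frobenius bound,
  -- which for `c` of order `n^(-1/2)` would not tend to zero.
  have h1 := Matrix.norm_sum_mul_mul_le M (Sum.elim (fun _ => 0) fun _ => 1)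
    (Sum.elim (fun _ => 1) fun _ => 0)
  have h2 := Matrix.norm_sum_mul_mul_le M (Sum.elim (fun _ => 1) fun _ => 0)
    (Sum.elim (fun _ => 0) fun _ => 1)
  simp only [Fintype.sum_sum_type, Sum.elim_inl, Sum.elim_inr, zero_mul, one_mul, mul_one,
    mul_zero, norm_zero, norm_one, Finset.sum_const_zero, zero_add, add_zero, one_pow,
    ne_eq, OfNat.ofNat_ne_zero, not_false_eq_true, zero_pow, Finset.sum_const, Finset.card_univ,
    nsmul_eq_mul, Real.mul_self_sqrt hc.le] at h1 h2
  have hMn := norm_skewResolvent_mul_le A B hη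
  have key : ((Matrix.fromBlocks 0 (A - B) (-(A - B)ᴴ) 0 : Matrix (ι ⊕ ι) (ι ⊕ ι) ℂ) * M).trace =
      c * (∑ x, ∑ y, M (.inr x) (.inl y)) - star c * ∑ x, ∑ y, M (.inl x) (.inr y) := by
    have hAB : A - B = Matrix.of fun _ _ => c := by ext i j; exact h i j
    rw [hAB, Matrix.trace, Fintype.sum_sum_type]
    simp only [Matrix.diag_apply, Matrix.mul_apply, Fintype.sum_sum_type,
      Matrix.fromBlocks_apply₁₁, Matrix.fromBlocks_apply₁₂, Matrix.fromBlocks_apply₂₁,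
      Matrix.fromBlocks_apply₂₂, Matrix.zero_apply, Matrix.neg_apply, Matrix.conjTranspose_apply,
      Matrix.of_apply, zero_mul, Finset.sum_const_zero, zero_add, add_zero, neg_mul, Finset.sum_neg_distrib]
    simp only [← Finset.mul_sum]
    rw [Finset.sum_comm (f := fun x y => M (.inr y) (.inl x)),
      Finset.sum_comm (f := fun x y => M (.inl y) (.inr x)), sub_eq_add_neg]
  have h3 : ‖((Matrix.fromBlocks 0 (A - B) (-(A - B)ᴴ) 0 : Matrix (ι ⊕ ι) (ι ⊕ ι) ℂ) *
      M).trace‖ ≤ 2 * (‖c‖ * (1 / η ^ 2 * Fintype.card ι)) := by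
    rw [key]
    refine (norm_sub_le _ _).trans ?_
    rw [norm_mul, norm_mul, norm_star, two_mul]
    gcongr
    · exact h1.trans (by gcongr)
    · exact h2.trans (by gcongr)
  refine (abs_resolventMean_sub_le_of_norm_trace_le A B hη h3).trans (le_of_eq ?_)
  field_simp

/-! ### Perturbation of one entry -/

section SingleEntry

variable {A B} {i j : ι} {y : ℂ}

/-- The resolvent identity for a perturbation of a single entry. -/
lemma skewResolvent_sub_of_single (hη : 0 < η) (h : A = B + Matrix.single i j y) (a b : ι ⊕ ι) :
    skewResolvent η A a b - skewResolvent η B a b =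
      -(y * skewResolvent η B a (.inl i) * skewResolvent η A (.inr j) b) +
        star y * skewResolvent η B a (.inr j) * skewResolvent η A (.inl i) b := by
  have hD : skewBlock η A - skewBlock η B =
      Matrix.single (.inl i) (.inr j) y - Matrix.single (.inr j) (.inl i) (star y) := by
    rw [skewBlock_sub, h, add_sub_cancel_left, fromBlocks_single]
  rw [← Matrix.sub_apply, skewResolvent_sub A B hη, hD, Matrix.mul_sub, Matrix.sub_mul]
  simp only [Matrix.neg_apply, Matrix.sub_apply, Matrix.mul_apply, Matrix.single_apply, mul_ite,
    ite_and, mul_zero, Finset.sum_ite_eq, Finset.mem_univ, if_true, ite_mul, zero_mul]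
  ring

lemma norm_skewResolvent_sub_le_of_single (hη : 0 < η) (h : A = B + Matrix.single i j y)
    (a b : ι ⊕ ι) :
    ‖skewResolvent η A a b - skewResolvent η B a b‖ ≤ 2 * ‖y‖ / η ^ 2 := by
  rw [skewResolvent_sub_of_single hη h]
  refine (norm_add_le _ _).trans ?_
  rw [norm_neg, norm_mul, norm_mul, norm_mul, norm_mul, norm_star]
  calc _ ≤ ‖y‖ * (1 / η) * (1 / η) + ‖y‖ * (1 / η) * (1 / η) := by
        gcongr <;> exact norm_skewResolvent_entry_le _ hη _ _
    _ = _ := by field_simp; ring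

/-- The second order expansion of the resolvent in a single entry. -/
lemma norm_skewResolvent_expansion_le (hη : 0 < η) (h : A = B + Matrix.single i j y)
    (a b : ι ⊕ ι) :
    ‖skewResolvent η A a b - (skewResolvent η B a b -
      y * skewResolvent η B a (.inl i) * skewResolvent η B (.inr j) b +
        star y * skewResolvent η B a (.inr j) * skewResolvent η B (.inl i) b)‖ ≤
      4 * ‖y‖ ^ 2 / η ^ 3 := by
  have h1 : skewResolvent η A a b - (skewResolvent η B a b -
      y * skewResolvent η B a (.inl i) * skewResolvent η B (.inr j) b +
        star y * skewResolvent η B a (.inr j) * skewResolvent η B (.inl i) b) =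
      -(y * skewResolvent η B a (.inl i) *
        (skewResolvent η A (.inr j) b - skewResolvent η B (.inr j) b)) +
      star y * skewResolvent η B a (.inr j) *
        (skewResolvent η A (.inl i) b - skewResolvent η B (.inl i) b) := by
    linear_combination skewResolvent_sub_of_single hη h a b
  rw [h1]
  refine (norm_add_le _ _).trans ?_
  rw [norm_neg, norm_mul, norm_mul, norm_mul, norm_mul, norm_star]
  calc _ ≤ ‖y‖ * (1 / η) * (2 * ‖y‖ / η ^ 2) + ‖y‖ * (1 / η) * (2 * ‖y‖ / η ^ 2) := by
        gcongr <;> first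
          | exact norm_skewResolvent_entry_le _ hη _ _
          | exact norm_skewResolvent_sub_le_of_single hη h _ _
    _ = _ := by field_simp; ring

/-- The trace pairing meets only two entries of the product of resolvents, so a factor `1 / n` is
gained over the entrywise bound. After scaling the entries by `n^(-1/2)`, the `n²` squared
differences sum to `O(1 / n)`, as the concentration inequality requires. -/
lemma abs_resolventMean_sub_le_of_single [Nonempty ι] (hη : 0 < η)
    (h : A = B + Matrix.single i j y) :
    |resolventMean η A - resolventMean η B| ≤ ‖y‖ / η ^ 2 / Fintype.card ι := by
  refine abs_resolventMean_sub_le_of_norm_trace_le A B hη ?_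
  set M := skewResolvent η A * skewResolvent η B with hM
  have hMn := norm_skewResolvent_mul_le A B hη
  have key : ((Matrix.fromBlocks 0 (A - B) (-(A - B)ᴴ) 0 : Matrix (ι ⊕ ι) (ι ⊕ ι) ℂ) * M).trace =
      y * M (.inr j) (.inl i) - star y * M (.inl i) (.inr j) := by
    have hD : (Matrix.fromBlocks 0 (A - B) (-(A - B)ᴴ) 0 : Matrix (ι ⊕ ι) (ι ⊕ ι) ℂ) =
        Matrix.single (.inl i) (.inr j) y - Matrix.single (.inr j) (.inl i) (star y) := by
      rw [h, add_sub_cancel_left, fromBlocks_single]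
    rw [hD, Matrix.sub_mul, Matrix.trace_sub, Matrix.trace_single_mul, Matrix.trace_single_mul,
      smul_eq_mul, smul_eq_mul]
  rw [key]
  refine (norm_sub_le _ _).trans ?_
  rw [norm_mul, norm_mul, norm_star, two_mul]
  calc _ ≤ ‖y‖ * (1 / η ^ 2) + ‖y‖ * (1 / η ^ 2) := by
        gcongr <;> exact (Matrix.norm_entry_le _ _ _).trans hMn
    _ = _ := by field_simp

end SingleEntry

/-- The resolvent depends continuously on the matrix. -/
lemma continuous_skewResolvent (hη : 0 < η) : Continuous (skewResolvent (ι := ι) η) := by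
  have hb : Continuous (skewBlock (ι := ι) η) :=
    continuous_const.matrix_fromBlocks continuous_id continuous_id.matrix_conjTranspose.neg
      continuous_const
  have : skewResolvent (ι := ι) η =
      fun A => ((skewBlock η A).det)⁻¹ • (skewBlock η A).adjugate := by
    funext A
    rw [skewResolvent, Matrix.inv_def, Ring.inverse_eq_inv']
  rw [this]
  exact (hb.matrix_det.inv₀ fun A => (skewBlock_isUnit_det A hη).ne_zero).smul hb.matrix_adjugate

end SkewResolvent

/-! ### McDiarmid's inequality -/

section BoundedDifferences

open scoped NNReal

variable {E : Type*} [MeasurableSpace E]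

/-- Integration over `E ^ (N + 1)` as an iterated integral. -/
lemma measurePreserving_finCons (μ : Measure E) [IsProbabilityMeasure μ] (N : ℕ) :
    MeasurePreserving (fun p : E × (Fin N → E) => (Fin.cons p.1 p.2 : Fin (N + 1) → E))
      (μ.prod (Measure.pi fun _ : Fin N => μ)) (Measure.pi fun _ : Fin (N + 1) => μ) := by
  have mp := (measurePreserving_piFinSuccAbove (fun _ : Fin (N + 1) => μ) 0).symm
  convert! mp using 1
  funext p
  exact (Fin.insertNth_zero' p.1 p.2).symm

/-- McDiarmid's inequality on a product space: a bounded function with differences bounded by `c`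
in each of `N` coordinates is sub-Gaussian with parameter `N c²`. -/
lemma hasSubgaussianMGF_of_bounded_differences (μ : Measure E) [IsProbabilityMeasure μ]
    (c : ℝ≥0) (N : ℕ) (f : (Fin N → E) → ℝ) (hf : Measurable f) {B : ℝ} (hB : ∀ x, |f x| ≤ B)
    (hc : ∀ x i a, |f (Function.update x i a) - f x| ≤ c) :
    HasSubgaussianMGF (fun x => f x - ∫ y, f y ∂(Measure.pi fun _ : Fin N => μ)) (N * c ^ 2)
      (Measure.pi fun _ : Fin N => μ) := by
  induction N with
  | zero =>
    have h : (fun x => f x - ∫ y, f y ∂(Measure.pi fun _ : Fin 0 => μ)) = fun _ => 0 := by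
      funext x
      have : f = fun _ => f x := by
        funext y; rw [Subsingleton.elim y x]
      rw [this]
      simp
    rw [h]
    constructor
    · intro t; simp
    · intro t; simp [mgf]
  | succ N ih =>
    have mp := measurePreserving_finCons μ N
    set π := Measure.pi fun _ : Fin N => μ with hπ
    have hF : Measurable fun p : E × (Fin N → E) => f (Fin.cons p.1 p.2) := hf.comp mp.measurable
    have hFint : Integrable (fun p : E × (Fin N → E) => f (Fin.cons p.1 p.2)) (μ.prod π) :=
      .of_bound hF.aestronglyMeasurable B (.of_forall fun p => hB _)
    have hsec : ∀ x : Fin N → E, Measurable fun a => f (Fin.cons a x) := fun x =>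
      hF.comp (measurable_id.prodMk measurable_const)
    have hsecint : ∀ x : Fin N → E, Integrable (fun a => f (Fin.cons a x)) μ := fun x =>
      .of_bound (hsec x).aestronglyMeasurable B (.of_forall fun p => hB _)
    -- Martingale step: `f - m = (f - g) + (g - m)`, where `g` averages out the first coordinate.
    -- Hoeffding's lemma handles `f - g` for fixed remaining coordinates, and the induction
    -- hypothesis handles `g - m`, since `g` inherits bound and differences.
    set g : (Fin N → E) → ℝ := fun x => ∫ a, f (Fin.cons a x) ∂μ with hg
    have hgm : Measurable g :=
      (hF.stronglyMeasurable.integral_prod_left' (μ := μ)).measurable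
    have hgB : ∀ x, |g x| ≤ B := fun x => by
      have := norm_integral_le_of_norm_le_const (μ := μ) (f := fun a => f (Fin.cons a x)) (C := B)
        (.of_forall fun p => hB _)
      simpa using this
    have hgc : ∀ x i a, |g (Function.update x i a) - g x| ≤ c := fun x i a => by
      have h1 : g (Function.update x i a) - g x =
          ∫ b, (f (Fin.cons b (Function.update x i a)) - f (Fin.cons b x)) ∂μ :=
        (integral_sub (hsecint _) (hsecint _)).symm
      have := norm_integral_le_of_norm_le_const (μ := μ)
        (f := fun b => f (Fin.cons b (Function.update x i a)) - f (Fin.cons b x)) (C := c)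
        (.of_forall fun b => by rw [Fin.cons_update]; exact hc _ _ _)
      rw [h1]
      simpa using this
    have hfm : ∫ y, f y ∂(Measure.pi fun _ : Fin (N + 1) => μ) = ∫ x, g x ∂π := by
      rw [← mp.map_eq, integral_map mp.measurable.aemeasurable hf.aestronglyMeasurable,
        integral_prod_symm _ hFint]
    have hih := ih g hgm hgB hgc
    rw [hfm]
    set m := ∫ x, g x ∂π with hm
    have hsub : ∀ x : Fin N → E,
        HasSubgaussianMGF (fun a => f (Fin.cons a x) - g x) (c ^ 2) μ := by
      intro x
      obtain ⟨a₀⟩ : Nonempty E := nonempty_of_isProbabilityMeasure μ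
      -- The interval is centred at the value at a reference point `a₀`. Its half-length `c` yields
      -- the parameter `c²`.
      have h := hasSubgaussianMGF_of_mem_Icc (μ := μ) (X := fun a => f (Fin.cons a x))
        (a := f (Fin.cons a₀ x) - c) (b := f (Fin.cons a₀ x) + c) (hsec x).aemeasurable
        (.of_forall fun a => by
          have := abs_le.1 (hc (Fin.cons a₀ x) 0 a)
          rw [Fin.update_cons_zero] at this
          constructor <;> linarith [this.1, this.2])
      convert! h using 1
      rw [← NNReal.coe_inj]
      push_cast
      rw [show f (Fin.cons a₀ x) + c - (f (Fin.cons a₀ x) - c) = 2 * (c : ℝ) by ring,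
        Real.norm_of_nonneg (by positivity)]
      ring
    have hmB : |m| ≤ B := by
      have := norm_integral_le_of_norm_le_const (μ := π) (f := g) (C := B) (.of_forall hgB)
      simpa using this
    have hexp : ∀ t : ℝ, Integrable (fun x => Real.exp (t * (f x - m)))
        (Measure.pi fun _ : Fin (N + 1) => μ) := fun t => by
      refine .of_bound (by fun_prop) (Real.exp (|t| * (B + B))) (.of_forall fun x => ?_)
      rw [Real.norm_eq_abs, Real.abs_exp, Real.exp_le_exp]
      refine (le_abs_self _).trans ?_
      rw [abs_mul]
      gcongr
      exact (abs_sub _ _).trans (add_le_add (hB x) hmB)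
    refine ⟨hexp, fun t => ?_⟩
    have hexp' : Integrable (fun p : E × (Fin N → E) => Real.exp (t * (f (Fin.cons p.1 p.2) - m)))
        (μ.prod π) := (mp.integrable_comp (hexp t).aestronglyMeasurable).2 (hexp t)
    have h1 : mgf (fun x => f x - m) (Measure.pi fun _ : Fin (N + 1) => μ) t =
        ∫ x, Real.exp (t * (g x - m)) * mgf (fun a => f (Fin.cons a x) - g x) μ t ∂π := by
      rw [mgf, ← mp.map_eq, integral_map mp.measurable.aemeasurable (by fun_prop),
        integral_prod_symm _ hexp']
      refine integral_congr_ae (.of_forall fun x => ?_)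
      simp only [mgf]
      rw [← integral_const_mul]
      refine integral_congr_ae (.of_forall fun a => ?_)
      simp only [← Real.exp_add]
      congr 1
      ring
    have h2 : ∫ x, Real.exp (t * (g x - m)) * mgf (fun a => f (Fin.cons a x) - g x) μ t ∂π ≤
        ∫ x, Real.exp (t * (g x - m)) * Real.exp (c ^ 2 * t ^ 2 / 2) ∂π := by
      refine integral_mono_of_nonneg (.of_forall fun x => ?_)
        ((hih.integrable_exp_mul t).mul_const _) (.of_forall fun x => ?_)
      · exact mul_nonneg (Real.exp_nonneg _) mgf_nonneg
      · refine mul_le_mul_of_nonneg_left ?_ (Real.exp_nonneg _)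
        simpa using (hsub x).mgf_le t
    rw [h1]
    refine h2.trans ?_
    rw [integral_mul_const]
    refine (mul_le_mul_of_nonneg_right (hih.mgf_le t) (Real.exp_nonneg _)).trans (le_of_eq ?_)
    rw [← Real.exp_add]
    congr 1
    push_cast
    ring

/-- McDiarmid's inequality for independent identically distributed random variables indexed by a
finite type. -/
lemma measureReal_abs_sub_integral_ge_le {Ω ι : Type*} [MeasurableSpace Ω] {P : Measure Ω}
    [IsProbabilityMeasure P] [Fintype ι] [DecidableEq ι] {X : ι → Ω → E}
    (hX : ∀ i, Measurable (X i)) (hind : iIndepFun X P) {μ : Measure E}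
    (hμ : ∀ i, P.map (X i) = μ) (c : ℝ≥0) (f : (ι → E) → ℝ) (hf : Measurable f) {B : ℝ}
    (hB : ∀ x, |f x| ≤ B) (hc : ∀ x i a, |f (Function.update x i a) - f x| ≤ c)
    {ε : ℝ} (hε : 0 ≤ ε) [IsProbabilityMeasure μ] :
    P.real {ω | ε ≤ |f (fun i => X i ω) - ∫ ω', f (fun i => X i ω') ∂P|} ≤
      2 * Real.exp (-ε ^ 2 / (2 * (Fintype.card ι * c ^ 2))) := by
  let e := Fintype.equivFin ι
  set N := Fintype.card ι
  let F : (Fin N → E) → ℝ := fun x => f (fun i => x (e i))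
  have hFm : Measurable F := hf.comp (measurable_pi_lambda _ fun i => measurable_pi_apply _)
  have hFc : ∀ x i a, |F (Function.update x i a) - F x| ≤ c := fun x i a => by
    have h : (fun j => Function.update x i a (e j)) =
        Function.update (fun j => x (e j)) (e.symm i) a := by
      funext j
      simp only [Function.update_apply, Equiv.eq_symm_apply]
    simp only [F]
    rw [h]
    exact hc _ _ _
  let Y : Ω → Fin N → E := fun ω k => X (e.symm k) ω
  have hY : Measurable Y := measurable_pi_lambda _ fun k => hX _
  have hmap : P.map Y = Measure.pi fun _ : Fin N => μ := by
    have h := (iIndepFun_iff_map_fun_eq_pi_map (f := fun k : Fin N => X (e.symm k))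
      fun k => (hX _).aemeasurable).1 (hind.precomp e.symm.injective)
    simp only [hμ] at h
    exact h
  have hFY : ∀ ω, F (Y ω) = f (fun i => X i ω) := fun ω => by simp [F, Y]
  have hInt : ∫ y, F y ∂(Measure.pi fun _ : Fin N => μ) = ∫ ω, f (fun i => X i ω) ∂P := by
    rw [← hmap, integral_map hY.aemeasurable hFm.aestronglyMeasurable]
    simp only [hFY]
  have hsg := hasSubgaussianMGF_of_bounded_differences μ c N F hFm (fun x => hB _) hFc
  have h1 := hsg.measure_ge_le hε
  have h2 := hsg.neg.measure_ge_le hε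
  rw [hInt, ← hmap] at h1 h2
  rw [map_measureReal_apply hY (measurableSet_le (by fun_prop) (by fun_prop))] at h1 h2
  simp only [Set.preimage_ofPred_eq, Pi.neg_apply, hFY] at h1 h2
  -- The factor `2` in the bound is a union over the upper and the lower tail.
  have hsub : {ω | ε ≤ |f (fun i => X i ω) - ∫ ω', f (fun i => X i ω') ∂P|} ⊆
      {ω | ε ≤ f (fun i => X i ω) - ∫ ω', f (fun i => X i ω') ∂P} ∪
      {ω | ε ≤ -(f (fun i => X i ω) - ∫ ω', f (fun i => X i ω') ∂P)} := fun ω hω => by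
    simp only [Set.mem_union, Set.mem_ofPred_eq] at hω ⊢
    exact le_abs.1 hω
  refine (measureReal_mono hsub).trans ((measureReal_union_le _ _).trans ?_)
  rw [two_mul]
  push_cast at h1 h2
  exact add_le_add h1 h2

end BoundedDifferences

/-! ### Independence and first order expansions under the expectation -/

section Independence

variable {Ω : Type*} [MeasurableSpace Ω] {P : Measure Ω}

/-- A coordinate of an independent family is independent of functions of the other coordinates. -/
lemma integral_mul_comp_update {ι : Type*} [Fintype ι] [DecidableEq ι] {Y : ι → Ω → ℂ}
    (hY : ∀ i, Measurable (Y i)) (hind : iIndepFun Y P) (p : ι) (a : ℂ) {h : ℂ → ℂ}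
    (hh : Measurable h) {Φ : (ι → ℂ) → ℂ} (hΦ : Measurable Φ) :
    ∫ ω, h (Y p ω) * Φ (Function.update (fun q => Y q ω) p a) ∂P =
      (∫ ω, h (Y p ω) ∂P) * ∫ ω, Φ (Function.update (fun q => Y q ω) p a) ∂P := by
  have hd : Disjoint ({p} : Finset ι) {p}ᶜ := disjoint_compl_right
  have hi := hind.indepFun_finset {p} {p}ᶜ hd hY
  -- `ψ` rebuilds the updated tuple from the coordinates other than `p`, so that the second factor
  -- is a function of these alone.
  let ψ : (((({p} : Finset ι)ᶜ : Finset ι)) → ℂ) → (ι → ℂ) := fun x q =>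
    if hq : q = p then a else x ⟨q, by simpa using hq⟩
  have hψ : Measurable ψ := by
    refine measurable_pi_lambda _ fun q => ?_
    by_cases hq : q = p
    · simp only [ψ, hq, dite_true]; exact measurable_const
    · simp only [ψ, hq, dite_false]; exact measurable_pi_apply _
  have hφ : Measurable fun x : ({p} : Finset ι) → ℂ => h (x ⟨p, by simp⟩) :=
    hh.comp (measurable_pi_apply _)
  have h2 := hi.comp (ψ := fun x => Φ (ψ x)) hφ (hΦ.comp hψ)
  have h3 : ∀ ω, ψ (fun q => Y q ω) = Function.update (fun q => Y q ω) p a := fun ω => by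
    funext q
    by_cases hq : q = p
    · subst hq; simp [ψ]
    · simp [ψ, hq]
  have h4 := h2.integral_fun_mul_eq_mul_integral
    (hh.comp (hY p)).aestronglyMeasurable
    ((hΦ.comp hψ).comp (measurable_pi_lambda _ fun q => hY q)).aestronglyMeasurable
  simpa only [Function.comp_def, h3] using h4

/-- Products of bounded random variables are close in mean if the factors are uniformly close. -/
lemma norm_integral_mul_sub_integral_mul_le [IsProbabilityMeasure P] {f₁ f₂ g₁ g₂ : Ω → ℂ}
    (hf₁ : Measurable f₁) (hf₂ : Measurable f₂) (hg₁ : Measurable g₁) (hg₂ : Measurable g₂)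
    {b d : ℝ} (bf₁ : ∀ ω, ‖f₁ ω‖ ≤ b) (bf₂ : ∀ ω, ‖f₂ ω‖ ≤ b) (bg₁ : ∀ ω, ‖g₁ ω‖ ≤ b)
    (bg₂ : ∀ ω, ‖g₂ ω‖ ≤ b) (h₁ : ∀ ω, ‖f₁ ω - g₁ ω‖ ≤ d) (h₂ : ∀ ω, ‖f₂ ω - g₂ ω‖ ≤ d) :
    ‖(∫ ω, f₁ ω * f₂ ω ∂P) - ∫ ω, g₁ ω * g₂ ω ∂P‖ ≤ 2 * b * d := by
  obtain ⟨ω₀⟩ := nonempty_of_isProbabilityMeasure P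
  have hb : 0 ≤ b := (norm_nonneg _).trans (bf₁ ω₀)
  have hd : 0 ≤ d := (norm_nonneg _).trans (h₁ ω₀)
  have hf : Integrable (fun ω => f₁ ω * f₂ ω) P :=
    .of_bound (hf₁.mul hf₂).aestronglyMeasurable (b * b) (.of_forall fun ω => by
      rw [norm_mul]; exact mul_le_mul (bf₁ ω) (bf₂ ω) (norm_nonneg _) hb)
  have hg : Integrable (fun ω => g₁ ω * g₂ ω) P :=
    .of_bound (hg₁.mul hg₂).aestronglyMeasurable (b * b) (.of_forall fun ω => by
      rw [norm_mul]; exact mul_le_mul (bg₁ ω) (bg₂ ω) (norm_nonneg _) hb)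
  rw [← integral_sub hf hg]
  have h := norm_integral_le_of_norm_le_const (μ := P)
    (f := fun ω => f₁ ω * f₂ ω - g₁ ω * g₂ ω) (C := 2 * b * d) (.of_forall fun ω => by
      rw [show f₁ ω * f₂ ω - g₁ ω * g₂ ω =
        (f₁ ω - g₁ ω) * f₂ ω + g₁ ω * (f₂ ω - g₂ ω) by ring]
      refine (norm_add_le _ _).trans ?_
      rw [norm_mul, norm_mul]
      have e1 := mul_le_mul (h₁ ω) (bf₂ ω) (norm_nonneg _) hd
      have e2 := mul_le_mul (bg₁ ω) (h₂ ω) (norm_nonneg _) hb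
      linarith)
  simpa using h

/-- Integration of a first order expansion in a bounded random variable `y`. -/
lemma norm_integral_mul_sub_le_of_expansion [IsProbabilityMeasure P] {y s t₀ t₁ t₂ : Ω → ℂ}
    (hy : Measurable y) (hs : Measurable s) (h₀ : Measurable t₀) (h₁ : Measurable t₁)
    (h₂ : Measurable t₂) {K b δ r : ℝ} {κ : ℂ} (hyK : ∀ ω, ‖y ω‖ ≤ K) (bs : ∀ ω, ‖s ω‖ ≤ b)
    (b₀ : ∀ ω, ‖t₀ ω‖ ≤ b) (b₁ : ∀ ω, ‖t₁ ω‖ ≤ b) (b₂ : ∀ ω, ‖t₂ ω‖ ≤ b)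
    (hr : ∀ ω, ‖s ω - (t₀ ω - δ * y ω * t₁ ω + star (δ * y ω) * t₂ ω)‖ ≤ r)
    (e₀ : ∫ ω, y ω * t₀ ω ∂P = 0) (e₁ : ∫ ω, y ω ^ 2 * t₁ ω ∂P = κ * ∫ ω, t₁ ω ∂P)
    (e₂ : ∫ ω, ((‖y ω‖ ^ 2 : ℝ) : ℂ) * t₂ ω ∂P = ∫ ω, t₂ ω ∂P) :
    ‖(∫ ω, y ω * s ω ∂P) - δ * ((∫ ω, t₂ ω ∂P) - κ * ∫ ω, t₁ ω ∂P)‖ ≤ K * r := by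
  obtain ⟨ω₀⟩ := nonempty_of_isProbabilityMeasure P
  have hK : 0 ≤ K := (norm_nonneg _).trans (hyK ω₀)
  have hInt : ∀ {t : Ω → ℂ}, Measurable t → (∀ ω, ‖t ω‖ ≤ b) → Integrable t P :=
    fun ht bt => .of_bound ht.aestronglyMeasurable b (.of_forall bt)
  have hys : Integrable (fun ω => y ω * s ω) P :=
    (hInt hs bs).bdd_mul (c := K) hy.aestronglyMeasurable (.of_forall hyK)
  have hy₀ : Integrable (fun ω => y ω * t₀ ω) P :=
    (hInt h₀ b₀).bdd_mul (c := K) hy.aestronglyMeasurable (.of_forall hyK)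
  have hy₁ : Integrable (fun ω => (δ : ℂ) * (y ω ^ 2 * t₁ ω)) P :=
    ((hInt h₁ b₁).bdd_mul (c := K ^ 2) (hy.pow_const 2).aestronglyMeasurable
      (.of_forall fun ω => by
        rw [norm_pow]; exact pow_le_pow_left₀ (norm_nonneg _) (hyK ω) 2)).const_mul _
  have hy₂ : Integrable (fun ω => (δ : ℂ) * (((‖y ω‖ ^ 2 : ℝ) : ℂ) * t₂ ω)) P :=
    ((hInt h₂ b₂).bdd_mul (c := K ^ 2) (Measurable.aestronglyMeasurable (by fun_prop))
      (.of_forall fun ω => by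
        rw [Complex.norm_real, norm_pow, norm_norm]
        exact pow_le_pow_left₀ (norm_nonneg _) (hyK ω) 2)).const_mul _
  -- Multiplied by `y`, the first order terms of the expansion carry `y²` and `|y|²`, matching `e₁`
  -- and `e₂`; what remains is `y` times the expansion error.
  have h := norm_integral_le_of_norm_le_const (μ := P)
    (f := fun ω => y ω * s ω - (y ω * t₀ ω - δ * (y ω ^ 2 * t₁ ω) +
      δ * (((‖y ω‖ ^ 2 : ℝ) : ℂ) * t₂ ω))) (C := K * r) (.of_forall fun ω => by
      have h2 : (((‖y ω‖ ^ 2 : ℝ) : ℂ)) = y ω * star (y ω) := by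
        rw [Complex.star_def, Complex.mul_conj']; norm_cast
      rw [h2, show y ω * s ω - (y ω * t₀ ω - δ * (y ω ^ 2 * t₁ ω) +
        δ * (y ω * star (y ω) * t₂ ω)) =
        y ω * (s ω - (t₀ ω - δ * y ω * t₁ ω + star (δ * y ω) * t₂ ω)) by
          rw [star_mul', Complex.star_def, Complex.conj_ofReal]; ring,
        norm_mul]
      exact mul_le_mul (hyK ω) (hr ω) (norm_nonneg _) hK)
  have hy₃ : Integrable (fun ω => y ω * t₀ ω - δ * (y ω ^ 2 * t₁ ω)) P := hy₀.sub hy₁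
  have hy₄ : Integrable (fun ω => y ω * t₀ ω - δ * (y ω ^ 2 * t₁ ω) +
    δ * (((‖y ω‖ ^ 2 : ℝ) : ℂ) * t₂ ω)) P := hy₃.add hy₂
  rw [integral_sub hys hy₄, integral_add hy₃ hy₂,
    integral_sub hy₀ hy₁, integral_const_mul, integral_const_mul, e₀, e₁, e₂] at h
  simp only [probReal_univ, mul_one] at h
  rw [show (∫ ω, y ω * s ω ∂P) - δ * ((∫ ω, t₂ ω ∂P) - κ * ∫ ω, t₁ ω ∂P) =
    (∫ ω, y ω * s ω ∂P) - (0 - δ * (κ * ∫ ω, t₁ ω ∂P) + δ * ∫ ω, t₂ ω ∂P) by ring]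
  exact h

end Independence

/-! ### The shifted matrix as a function of its entries -/

section EntryMatrix

variable {n : ℕ} (z : ℂ)

/-- The matrix `n^{-1/2} y - z I` as a function of the table of entries `y`. -/
def entryMatrix (z : ℂ) (y : Fin n × Fin n → ℂ) : Matrix (Fin n) (Fin n) ℂ :=
  Matrix.of (fun i j => ((Real.sqrt n : ℝ) : ℂ)⁻¹ * y (i, j)) - z • 1

lemma shiftedMatrix_eq_entryMatrix {Ω : Type*} (X : ℕ → ℕ → Ω → ℂ) (ω : Ω) :
    shiftedMatrix X z n ω = entryMatrix z fun p => X p.1 p.2 ω := by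
  ext i j
  simp [shiftedMatrix, entryMatrix, cornerMatrix]

lemma continuous_entryMatrix : Continuous (entryMatrix (n := n) z) := by
  unfold entryMatrix
  refine Continuous.sub ?_ continuous_const
  exact continuous_matrix fun i j => continuous_const.mul (continuous_apply _)

lemma entryMatrix_update (y : Fin n × Fin n → ℂ) (p : Fin n × Fin n) (a : ℂ) :
    entryMatrix z (Function.update y p a) = entryMatrix z y +
      Matrix.single p.1 p.2 (((Real.sqrt n : ℝ) : ℂ)⁻¹ * (a - y p)) := by
  ext i j
  by_cases h : (i, j) = p
  · subst h; simp [entryMatrix]; ring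
  · have h' : ¬ (p.1 = i ∧ p.2 = j) := fun h2 => h (Prod.ext h2.1.symm h2.2.symm)
    simp [entryMatrix, Function.update_of_ne h, h']

lemma entryMatrix_eq_update_zero_add (y : Fin n × Fin n → ℂ) (p : Fin n × Fin n) :
    entryMatrix z y = entryMatrix z (Function.update y p 0) +
      Matrix.single p.1 p.2 (((Real.sqrt n : ℝ) : ℂ)⁻¹ * y p) := by
  have h := entryMatrix_update z (Function.update y p 0) p (y p)
  simpa using h

lemma norm_inv_sqrt_natCast : ‖((Real.sqrt n : ℝ) : ℂ)⁻¹‖ = (√n)⁻¹ := by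
  rw [norm_inv, Complex.norm_real, Real.norm_of_nonneg (Real.sqrt_nonneg _)]

end EntryMatrix

/-- A table of i.i.d. centred complex random variables of unit variance, bounded by `K`. -/
structure IsBoundedTable {Ω : Type*} [MeasurableSpace Ω] (P : Measure Ω)
    (Y : ℕ → ℕ → Ω → ℂ) (K : ℝ) : Prop where
  measurable : ∀ i j, Measurable (Y i j)
  indep : iIndepFun (fun p : ℕ × ℕ => Y p.1 p.2) P
  identDistrib : ∀ i j, IdentDistrib (Y i j) (Y 0 0) P P
  norm_le : ∀ i j ω, ‖Y i j ω‖ ≤ K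
  integral_eq_zero : ∫ ω, Y 0 0 ω ∂P = 0
  integral_sq_eq_one : ∫ ω, ‖Y 0 0 ω‖ ^ 2 ∂P = 1

/-! ### Cumulant expansion for bounded entries -/

namespace IsBoundedTable

variable {Ω : Type*} [MeasurableSpace Ω] {P : Measure Ω}
  {Y : ℕ → ℕ → Ω → ℂ} {K : ℝ} {n : ℕ} {η : ℝ}

lemma nonneg [IsProbabilityMeasure P] (hY : IsBoundedTable P Y K) : 0 ≤ K := by
  obtain ⟨ω⟩ := nonempty_of_isProbabilityMeasure P
  exact (norm_nonneg _).trans (hY.norm_le 0 0 ω)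

/-- The entries of the `n × n` corner, as a family indexed by `Fin n × Fin n`. -/
lemma indep_corner (hY : IsBoundedTable P Y K) (n : ℕ) :
    iIndepFun (fun p : Fin n × Fin n => Y p.1 p.2) P :=
  hY.indep.precomp (g := fun p : Fin n × Fin n => ((p.1 : ℕ), (p.2 : ℕ)))
    fun p q h => by simpa [Prod.ext_iff, Fin.ext_iff] using h

lemma measurable_entries (hY : IsBoundedTable P Y K) (n : ℕ) :
    Measurable fun ω => fun p : Fin n × Fin n => Y p.1 p.2 ω :=
  measurable_pi_lambda _ fun _ => hY.measurable _ _

lemma measurable_shiftedResolvent (hη : 0 < η) (z : ℂ) (a b : Fin n ⊕ Fin n) :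
    Measurable fun y : Fin n × Fin n → ℂ => skewResolvent η (entryMatrix z y) a b :=
  (((continuous_skewResolvent hη).comp (continuous_entryMatrix z)).matrix_elem a b).measurable

/-- The cumulant expansion of the correlation of an entry with the resolvent. -/
lemma norm_integral_entry_mul_resolvent_sub_le [IsProbabilityMeasure P]
    (hY : IsBoundedTable P Y K)
    (hη : 0 < η) (z : ℂ) (i j : Fin n) (c : Fin n ⊕ Fin n) :
    ‖(∫ ω, Y i j ω * skewResolvent η (shiftedMatrix Y z n ω) (.inr j) c ∂P) -
      ((√n : ℝ) : ℂ)⁻¹ *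
        ((∫ ω, skewResolvent η (shiftedMatrix Y z n ω) (.inr j) (.inr j) *
            skewResolvent η (shiftedMatrix Y z n ω) (.inl i) c ∂P) -
          (∫ ω, Y 0 0 ω ^ 2 ∂P) *
            ∫ ω, skewResolvent η (shiftedMatrix Y z n ω) (.inr j) (.inl i) *
              skewResolvent η (shiftedMatrix Y z n ω) (.inr j) c ∂P)‖ ≤
      (8 * K ^ 3 + 4 * K) / η ^ 3 * ((√n)⁻¹) ^ 2 := by
  set p : Fin n × Fin n := (i, j) with hp
  set δ : ℝ := (√n)⁻¹ with hδ
  have hδ0 : 0 ≤ δ := by positivity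
  have hK := hY.nonneg
  set y : Ω → Fin n × Fin n → ℂ := fun ω q => Y q.1 q.2 ω with hy
  set S : Ω → Matrix (Fin n ⊕ Fin n) (Fin n ⊕ Fin n) ℂ :=
    fun ω => skewResolvent η (shiftedMatrix Y z n ω) with hS
  -- `T` is the resolvent with the entry `(i, j)` set to zero. It is independent of `Y i j` and
  -- within `O(δ)` of `S`.
  set T : Ω → Matrix (Fin n ⊕ Fin n) (Fin n ⊕ Fin n) ℂ :=
    fun ω => skewResolvent η (entryMatrix z (Function.update (y ω) p 0)) with hT
  have hSA : ∀ ω, shiftedMatrix Y z n ω = entryMatrix z (Function.update (y ω) p 0) +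
      Matrix.single i j ((δ : ℂ) * Y i j ω) := fun ω => by
    rw [shiftedMatrix_eq_entryMatrix, entryMatrix_eq_update_zero_add z _ p]
    simp [hδ, hy, hp]
  have hnd : ∀ ω, ‖(δ : ℂ) * Y i j ω‖ ≤ δ * K := fun ω => by
    rw [norm_mul, Complex.norm_real, Real.norm_of_nonneg hδ0]
    exact mul_le_mul_of_nonneg_left (hY.norm_le i j ω) hδ0
  have hSm : ∀ a b, Measurable fun ω => S ω a b := fun a b => by
    simp only [hS, shiftedMatrix_eq_entryMatrix]
    exact (measurable_shiftedResolvent hη z a b).comp (hY.measurable_entries n)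
  have hupd : Measurable fun ω => Function.update (y ω) p 0 :=
    (measurable_update' (a := p)).comp ((hY.measurable_entries n).prodMk measurable_const)
  have hTm : ∀ a b, Measurable fun ω => T ω a b := fun a b =>
    (measurable_shiftedResolvent hη z a b).comp hupd
  have hSb : ∀ ω a b, ‖S ω a b‖ ≤ 1 / η := fun ω a b => norm_skewResolvent_entry_le _ hη a b
  have hTb : ∀ ω a b, ‖T ω a b‖ ≤ 1 / η := fun ω a b => norm_skewResolvent_entry_le _ hη a b
  have hST : ∀ ω a b, ‖T ω a b - S ω a b‖ ≤ 2 * (δ * K) / η ^ 2 := fun ω a b => by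
    rw [norm_sub_rev]
    refine (norm_skewResolvent_sub_le_of_single hη (hSA ω) a b).trans ?_
    gcongr
    exact hnd ω
  have hdiff : ∀ a b d e, ‖(∫ ω, T ω a b * T ω d e ∂P) - ∫ ω, S ω a b * S ω d e ∂P‖ ≤
      2 * (1 / η) * (2 * (δ * K) / η ^ 2) := fun a b d e =>
    norm_integral_mul_sub_integral_mul_le (hTm a b) (hTm d e) (hSm a b) (hSm d e)
      (fun ω => hTb ω a b) (fun ω => hTb ω d e) (fun ω => hSb ω a b) (fun ω => hSb ω d e)
      (fun ω => hST ω a b) (fun ω => hST ω d e)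
  have hI : ∀ {h : ℂ → ℂ}, Measurable h → ∀ a b d e,
      ∫ ω, h (Y i j ω) * (T ω a b * T ω d e) ∂P =
        (∫ ω, h (Y 0 0 ω) ∂P) * ∫ ω, T ω a b * T ω d e ∂P := fun {h} hh a b d e => by
    have h1 := integral_mul_comp_update (fun q : Fin n × Fin n => hY.measurable q.1 q.2)
      (hY.indep_corner n) p 0 hh (Φ := fun y => skewResolvent η (entryMatrix z y) a b *
        skewResolvent η (entryMatrix z y) d e)
      ((measurable_shiftedResolvent hη z a b).mul (measurable_shiftedResolvent hη z d e))
    have h2 : ∫ ω, h (Y i j ω) ∂P = ∫ ω, h (Y 0 0 ω) ∂P :=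
      ((hY.identDistrib i j).comp hh).integral_eq
    rw [← h2]
    exact h1
  have hI1 : ∫ ω, Y i j ω * T ω (.inr j) c ∂P = 0 := by
    have h1 := integral_mul_comp_update (fun q : Fin n × Fin n => hY.measurable q.1 q.2)
      (hY.indep_corner n) p 0 measurable_id
      (Φ := fun y => skewResolvent η (entryMatrix z y) (.inr j) c)
      (measurable_shiftedResolvent hη z _ _)
    have h2 : ∫ ω, Y i j ω ∂P = 0 := by
      rw [(hY.identDistrib i j).integral_eq, hY.integral_eq_zero]
    refine h1.trans ?_
    simp only [id, hp, h2, zero_mul]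
  have hI2 := hI (h := fun x => x ^ 2) (measurable_id.pow_const 2) (.inr j) (.inl i) (.inr j) c
  have hI3 : ∫ ω, ((‖Y i j ω‖ ^ 2 : ℝ) : ℂ) * (T ω (.inr j) (.inr j) * T ω (.inl i) c) ∂P =
      ∫ ω, T ω (.inr j) (.inr j) * T ω (.inl i) c ∂P := by
    rw [hI (h := fun x => ((‖x‖ ^ 2 : ℝ) : ℂ)) (by fun_prop) (.inr j) (.inr j) (.inl i) c,
      integral_complex_ofReal, hY.integral_sq_eq_one]
    simp
  have hexp : ∀ ω, ‖S ω (.inr j) c - (T ω (.inr j) c -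
      (δ : ℂ) * Y i j ω * (T ω (.inr j) (.inl i) * T ω (.inr j) c) +
      star ((δ : ℂ) * Y i j ω) * (T ω (.inr j) (.inr j) * T ω (.inl i) c))‖ ≤
      4 * (δ * K) ^ 2 / η ^ 3 := fun ω => by
    have h1 := norm_skewResolvent_expansion_le hη (hSA ω) (.inr j) c
    rw [← mul_assoc, ← mul_assoc]
    refine h1.trans ?_
    have h2 := pow_le_pow_left₀ (norm_nonneg _) (hnd ω) 2
    gcongr
  change ‖(∫ ω, Y i j ω * S ω (.inr j) c ∂P) - ((√n : ℝ) : ℂ)⁻¹ *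
    ((∫ ω, S ω (.inr j) (.inr j) * S ω (.inl i) c ∂P) - (∫ ω, Y 0 0 ω ^ 2 ∂P) *
      ∫ ω, S ω (.inr j) (.inl i) * S ω (.inr j) c ∂P)‖ ≤ _
  clear_value S T
  have hη1 : 0 ≤ 1 / η := by positivity
  -- A single bound is needed for entries, at most `1 / η`, and for their products, at most `1 /
  -- η²`; the sum dominates both. It does not enter the resulting estimate.
  have hTTb : ∀ a b d e ω, ‖T ω a b * T ω d e‖ ≤ 1 / η + 1 / η * (1 / η) := fun a b d e ω => by
    rw [norm_mul]
    have := mul_le_mul (hTb ω a b) (hTb ω d e) (norm_nonneg _) hη1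
    linarith
  have hle : ∀ x, x ≤ 1 / η → x ≤ 1 / η + 1 / η * (1 / η) := fun x hx => by
    have : 0 ≤ 1 / η * (1 / η) := mul_nonneg hη1 hη1
    linarith
  have hrem := norm_integral_mul_sub_le_of_expansion (P := P) (hY.measurable i j)
    (hSm (.inr j) c) (hTm (.inr j) c) ((hTm (.inr j) (.inl i)).mul (hTm (.inr j) c))
    ((hTm (.inr j) (.inr j)).mul (hTm (.inl i) c)) (hY.norm_le i j)
    (fun ω => hle _ (hSb ω (.inr j) c)) (fun ω => hle _ (hTb ω (.inr j) c))
    (hTTb _ _ _ _) (hTTb _ _ _ _) hexp hI1 hI2 hI3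
  have hκ : ‖∫ ω, Y 0 0 ω ^ 2 ∂P‖ ≤ K ^ 2 := by
    have h := norm_integral_le_of_norm_le_const (μ := P) (f := fun ω => Y 0 0 ω ^ 2) (C := K ^ 2)
      (.of_forall fun ω => by
        rw [norm_pow]; exact pow_le_pow_left₀ (norm_nonneg _) (hY.norm_le 0 0 ω) 2)
    simpa using h
  have hd1 := hdiff (.inr j) (.inr j) (.inl i) c
  have hd2 := hdiff (.inr j) (.inl i) (.inr j) c
  rw [show ((√n : ℝ) : ℂ)⁻¹ = (δ : ℂ) by simp [hδ]]
  generalize (∫ ω, Y 0 0 ω ^ 2 ∂P) = κ at *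
  generalize (∫ ω, T ω (.inr j) (.inr j) * T ω (.inl i) c ∂P) = IT1 at *
  generalize (∫ ω, T ω (.inr j) (.inl i) * T ω (.inr j) c ∂P) = IT2 at *
  generalize (∫ ω, S ω (.inr j) (.inr j) * S ω (.inl i) c ∂P) = IS1 at *
  generalize (∫ ω, S ω (.inr j) (.inl i) * S ω (.inr j) c ∂P) = IS2 at *
  generalize (∫ ω, Y i j ω * S ω (.inr j) c ∂P) = IYS at *
  -- Expansion error plus the cost of replacing `T` by `S`. The former contributes `4 K³`, the
  -- latter `4 K` and, through `|κ| ≤ K²`, another `4 K³`, all over `η³` and times `δ²`.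
  rw [show IYS - δ * (IS1 - κ * IS2) = (IYS - δ * (IT1 - κ * IT2)) +
    (δ * (IT1 - IS1) - δ * (κ * (IT2 - IS2))) by ring]
  refine (norm_add_le _ _).trans ((add_le_add hrem (norm_sub_le _ _)).trans ?_)
  rw [norm_mul, norm_mul, norm_mul, Complex.norm_real, Real.norm_of_nonneg hδ0]
  have hd3 := mul_le_mul hκ hd2 (norm_nonneg _) (by positivity)
  calc _ ≤ K * (4 * (δ * K) ^ 2 / η ^ 3) + (δ * (2 * (1 / η) * (2 * (δ * K) / η ^ 2)) +
        δ * (K ^ 2 * (2 * (1 / η) * (2 * (δ * K) / η ^ 2)))) :=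
        add_le_add le_rfl (add_le_add (mul_le_mul_of_nonneg_left hd1 hδ0)
          (mul_le_mul_of_nonneg_left hd3 hδ0))
    _ = _ := by field_simp; ring

end IsBoundedTable

/-! ### Approximate Schwinger–Dyson equations -/

open scoped Matrix Matrix.Norms.L2Operator in
/-- Row sums of squares of resolvent entries, along an injection. -/
lemma sum_sq_norm_skewResolvent_le {ι : Type*} [Fintype ι] [DecidableEq ι] {η : ℝ} (hη : 0 < η)
    (A : Matrix ι ι ℂ) (a : ι ⊕ ι) {c : ι → ι ⊕ ι} (hc : Function.Injective c) :
    ∑ i, ‖skewResolvent η A a (c i)‖ ^ 2 ≤ 1 / η ^ 2 := by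
  calc ∑ i, ‖skewResolvent η A a (c i)‖ ^ 2
      = ∑ b ∈ Finset.univ.map ⟨c, hc⟩, ‖skewResolvent η A a b‖ ^ 2 := by
        rw [Finset.sum_map]; rfl
    _ ≤ ∑ b, ‖skewResolvent η A a b‖ ^ 2 :=
        Finset.sum_le_sum_of_subset_of_nonneg (Finset.subset_univ _) fun _ _ _ => sq_nonneg _
    _ ≤ ‖skewResolvent η A‖ ^ 2 := Matrix.sum_sq_norm_row_le _ _
    _ ≤ (1 / η) ^ 2 := pow_le_pow_left₀ (norm_nonneg _) (norm_skewResolvent_le A hη) 2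
    _ = 1 / η ^ 2 := by rw [div_pow, one_pow]

/-- Rows of the resolvent have Euclidean norm at most `1 / η`, so each `j` contributes `O(1)`
although it carries `n` summands. This makes the term with `E Y²` negligible, so the limit does not
see it. -/
lemma norm_sum_sum_skewResolvent_mul_le {ι : Type*} [Fintype ι] [DecidableEq ι] {η : ℝ}
    (hη : 0 < η) (A : Matrix ι ι ℂ) {c : ι → ι ⊕ ι} (hc : Function.Injective c) :
    ‖∑ i, ∑ j, skewResolvent η A (.inr j) (.inl i) * skewResolvent η A (.inr j) (c i)‖ ≤
      Fintype.card ι / η ^ 2 := by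
  rw [Finset.sum_comm]
  refine (norm_sum_le _ _).trans ?_
  calc _ ≤ ∑ _j : ι, 1 / η ^ 2 := by
        refine Finset.sum_le_sum fun j _ => ?_
        have h1 := sum_sq_norm_skewResolvent_le hη A (.inr j) (Sum.inl_injective (β := ι))
        have h2 := sum_sq_norm_skewResolvent_le hη A (.inr j) hc
        have h3 : ‖∑ i, skewResolvent η A (.inr j) (.inl i) * skewResolvent η A (.inr j) (c i)‖ ≤
            ∑ i, (‖skewResolvent η A (.inr j) (.inl i)‖ ^ 2 +
              ‖skewResolvent η A (.inr j) (c i)‖ ^ 2) / 2 := by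
          refine (norm_sum_le _ _).trans (Finset.sum_le_sum fun i _ => ?_)
          rw [norm_mul]
          linarith [two_mul_le_add_sq ‖skewResolvent η A (.inr j) (.inl i)‖
            ‖skewResolvent η A (.inr j) (c i)‖]
        rw [← Finset.sum_div, Finset.sum_add_distrib] at h3
        linarith
    _ = _ := by simp [div_eq_mul_inv]

/-- The averaged row equation of the resolvent. -/
lemma average_row_eq {Ω : Type*} {Y : ℕ → ℕ → Ω → ℂ} {n : ℕ} {η : ℝ} (hη : 0 < η) (z : ℂ)
    (c : Fin n → Fin n ⊕ Fin n) (ω : Ω) :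
    η * ((n : ℂ)⁻¹ * ∑ i, skewResolvent η (shiftedMatrix Y z n ω) (.inl i) (c i)) +
      (n : ℂ)⁻¹ * ((√n : ℝ) : ℂ)⁻¹ *
        (∑ i : Fin n, ∑ j : Fin n, Y i j ω * skewResolvent η (shiftedMatrix Y z n ω) (.inr j) (c i)) -
      z * ((n : ℂ)⁻¹ * ∑ i, skewResolvent η (shiftedMatrix Y z n ω) (.inr i) (c i)) =
      (n : ℂ)⁻¹ * ∑ i, (1 : Matrix (Fin n ⊕ Fin n) (Fin n ⊕ Fin n) ℂ) (.inl i) (c i) := by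
  set S := skewResolvent η (shiftedMatrix Y z n ω) with hS
  have hrow : ∀ i, η * S (.inl i) (c i) + (((√n : ℝ) : ℂ)⁻¹ * (∑ j : Fin n, Y i j ω * S (.inr j) (c i)) -
      z * S (.inr i) (c i)) = (1 : Matrix (Fin n ⊕ Fin n) (Fin n ⊕ Fin n) ℂ) (.inl i) (c i) := by
    intro i
    rw [← skewResolvent_row_eq (shiftedMatrix Y z n ω) hη i (c i), ← hS]
    congr 1
    simp only [shiftedMatrix, cornerMatrix, Matrix.sub_apply, Matrix.smul_apply, Matrix.of_apply,
      smul_eq_mul, sub_mul, Finset.sum_sub_distrib, Matrix.one_apply, mul_ite, mul_one, mul_zero,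
      ite_mul, zero_mul, Finset.sum_ite_eq, Finset.mem_univ, if_true, Finset.mul_sum, mul_assoc]
  rw [← Finset.sum_congr rfl fun i _ => hrow i, Finset.sum_add_distrib, Finset.sum_sub_distrib,
    ← Finset.mul_sum, ← Finset.mul_sum, ← Finset.mul_sum]
  ring

namespace IsBoundedTable

variable {Ω : Type*} [MeasurableSpace Ω] {P : Measure Ω} {Y : ℕ → ℕ → Ω → ℂ} {K : ℝ} {n : ℕ}
  {η : ℝ}

lemma measurable_resolvent (hY : IsBoundedTable P Y K) (hη : 0 < η) (z : ℂ)
    (a b : Fin n ⊕ Fin n) : Measurable fun ω => skewResolvent η (shiftedMatrix Y z n ω) a b := by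
  simp only [shiftedMatrix_eq_entryMatrix]
  exact (measurable_shiftedResolvent hη z a b).comp (hY.measurable_entries n)

lemma integrable_resolvent [IsProbabilityMeasure P] (hY : IsBoundedTable P Y K) (hη : 0 < η)
    (z : ℂ) (a b : Fin n ⊕ Fin n) :
    Integrable (fun ω => skewResolvent η (shiftedMatrix Y z n ω) a b) P :=
  .of_bound (hY.measurable_resolvent hη z a b).aestronglyMeasurable (1 / η)
    (.of_forall fun _ => norm_skewResolvent_entry_le _ hη a b)

lemma integrable_resolvent_mul [IsProbabilityMeasure P] (hY : IsBoundedTable P Y K) (hη : 0 < η)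
    (z : ℂ) (a b d e : Fin n ⊕ Fin n) :
    Integrable (fun ω => skewResolvent η (shiftedMatrix Y z n ω) a b *
      skewResolvent η (shiftedMatrix Y z n ω) d e) P :=
  (hY.integrable_resolvent hη z d e).bdd_mul (c := 1 / η)
    (hY.measurable_resolvent hη z a b).aestronglyMeasurable
    (.of_forall fun _ => norm_skewResolvent_entry_le _ hη a b)

lemma integrable_entry_mul_resolvent [IsProbabilityMeasure P] (hY : IsBoundedTable P Y K)
    (hη : 0 < η) (z : ℂ) (i j : ℕ) (a b : Fin n ⊕ Fin n) :
    Integrable (fun ω => Y i j ω * skewResolvent η (shiftedMatrix Y z n ω) a b) P :=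
  (hY.integrable_resolvent hη z a b).bdd_mul (c := K)
    (hY.measurable i j).aestronglyMeasurable (.of_forall (hY.norm_le i j))

/-- The approximate Schwinger–Dyson equations. -/
lemma norm_schwingerDyson_le [IsProbabilityMeasure P] [NeZero n] (hY : IsBoundedTable P Y K)
    (hη : 0 < η) (z : ℂ) {c : Fin n → Fin n ⊕ Fin n} (hc : Function.Injective c) :
    ‖η * (∫ ω, (n : ℂ)⁻¹ * ∑ i, skewResolvent η (shiftedMatrix Y z n ω) (.inl i) (c i) ∂P) +
      (∫ ω, (resolventMean η (shiftedMatrix Y z n ω) : ℂ) *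
        ((n : ℂ)⁻¹ * ∑ i, skewResolvent η (shiftedMatrix Y z n ω) (.inl i) (c i)) ∂P) -
      z * (∫ ω, (n : ℂ)⁻¹ * ∑ i, skewResolvent η (shiftedMatrix Y z n ω) (.inr i) (c i) ∂P) -
      (n : ℂ)⁻¹ * ∑ i, (1 : Matrix (Fin n ⊕ Fin n) (Fin n ⊕ Fin n) ℂ) (.inl i) (c i)‖ ≤
      ((8 * K ^ 3 + 4 * K) / η ^ 3 + K ^ 2 / η ^ 2) * (√n)⁻¹ := by
  have hn : (n : ℝ) ≠ 0 := by exact_mod_cast NeZero.ne n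
  have hn0 : (0 : ℝ) < n := by exact_mod_cast Nat.pos_of_ne_zero (NeZero.ne n)
  have hnC : (n : ℂ) ≠ 0 := by exact_mod_cast NeZero.ne n
  have hK := hY.nonneg
  set δ : ℝ := (√n)⁻¹ with hδ
  have hδ0 : 0 ≤ δ := by positivity
  have hδ2 : δ ^ 2 = (n : ℝ)⁻¹ := by rw [hδ, inv_pow, Real.sq_sqrt hn0.le]
  have hδ1 : δ ≤ 1 := by
    have h1 : (1 : ℝ) ≤ n := by exact_mod_cast Nat.pos_of_ne_zero (NeZero.ne n)
    exact inv_le_one_of_one_le₀ (Real.one_le_sqrt.2 h1)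
  have hδC : ((√n : ℝ) : ℂ)⁻¹ = (δ : ℂ) := by simp [hδ]
  have hδ2C : (δ : ℂ) ^ 2 = (n : ℂ)⁻¹ := by
    rw [← Complex.ofReal_pow, hδ2]; simp
  obtain ⟨S, hS⟩ : ∃ S : Ω → Matrix (Fin n ⊕ Fin n) (Fin n ⊕ Fin n) ℂ,
    S = fun ω => skewResolvent η (shiftedMatrix Y z n ω) := ⟨_, rfl⟩
  have hS' : ∀ ω, skewResolvent η (shiftedMatrix Y z n ω) = S ω := fun ω => by rw [hS]
  have hSi : ∀ a b, Integrable (fun ω => S ω a b) P := by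
    rw [hS]; exact hY.integrable_resolvent hη z
  have hSSi : ∀ a b d e, Integrable (fun ω => S ω a b * S ω d e) P := by
    rw [hS]; exact hY.integrable_resolvent_mul hη z
  have hYSi : ∀ (i j : Fin n) a b, Integrable (fun ω => Y i j ω * S ω a b) P := by
    rw [hS]; exact fun i j a b => hY.integrable_entry_mul_resolvent hη z i j a b
  have hmain : ∀ i j : Fin n, ‖(∫ ω, Y i j ω * S ω (.inr j) (c i) ∂P) -
      (δ : ℂ) * ((∫ ω, S ω (.inr j) (.inr j) * S ω (.inl i) (c i) ∂P) -
        (∫ ω, Y 0 0 ω ^ 2 ∂P) * ∫ ω, S ω (.inr j) (.inl i) * S ω (.inr j) (c i) ∂P)‖ ≤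
      (8 * K ^ 3 + 4 * K) / η ^ 3 * δ ^ 2 := fun i j => by
    have := hY.norm_integral_entry_mul_resolvent_sub_le hη z i j (c i)
    simp only [hS', hδC] at this
    exact this
  have hrow := fun ω => average_row_eq (Y := Y) hη z c ω
  have hm : ∀ ω, (resolventMean η (shiftedMatrix Y z n ω) : ℂ) =
      (n : ℂ)⁻¹ * ∑ j, S ω (.inr j) (.inr j) := fun ω => by
    rw [ofReal_resolventMean_eq_inr _ hη, Fintype.card_fin, hS']
  have hpair : ∀ ω, ‖∑ i, ∑ j, S ω (.inr j) (.inl i) * S ω (.inr j) (c i)‖ ≤ n / η ^ 2 :=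
    fun ω => by
      have := norm_sum_sum_skewResolvent_mul_le hη (shiftedMatrix Y z n ω) hc
      rwa [hS', Fintype.card_fin] at this
  simp only [hS', hm, hδC] at hrow ⊢
  have hκ : ‖∫ ω, Y 0 0 ω ^ 2 ∂P‖ ≤ K ^ 2 := by
    have h := norm_integral_le_of_norm_le_const (μ := P) (f := fun ω => Y 0 0 ω ^ 2) (C := K ^ 2)
      (.of_forall fun ω => by
        rw [norm_pow]; exact pow_le_pow_left₀ (norm_nonneg _) (hY.norm_le 0 0 ω) 2)
    simpa using h
  -- the integrated row equation
  have hI1 : Integrable (fun ω => (η : ℂ) * ((n : ℂ)⁻¹ * ∑ i, S ω (.inl i) (c i))) P :=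
    ((integrable_finsetSum _ fun i _ => hSi _ _).const_mul _).const_mul _
  have hI2 : Integrable (fun ω => (n : ℂ)⁻¹ * δ * ∑ i : Fin n, ∑ j : Fin n, Y i j ω * S ω (.inr j) (c i)) P :=
    (integrable_finsetSum _ fun i _ => integrable_finsetSum _ fun j _ => hYSi i j _ _).const_mul _
  have hI3 : Integrable (fun ω => z * ((n : ℂ)⁻¹ * ∑ i, S ω (.inr i) (c i))) P :=
    ((integrable_finsetSum _ fun i _ => hSi _ _).const_mul _).const_mul _
  have hI12 : Integrable (fun ω => (η : ℂ) * ((n : ℂ)⁻¹ * ∑ i, S ω (.inl i) (c i)) +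
    (n : ℂ)⁻¹ * δ * ∑ i : Fin n, ∑ j : Fin n, Y i j ω * S ω (.inr j) (c i)) P := hI1.add hI2
  have hInt := integral_congr_ae (μ := P) (.of_forall hrow)
  rw [integral_sub hI12 hI3, integral_add hI1 hI2, integral_const_mul (η : ℂ),
    integral_const_mul ((n : ℂ)⁻¹ * δ), integral_const_mul z, integral_const, probReal_univ, one_smul,
    integral_finsetSum _ fun i _ => integrable_finsetSum _ fun j _ => hYSi i j _ _] at hInt
  simp only [integral_finsetSum _ fun j _ => hYSi _ j _ _] at hInt
  -- the product term as a double sum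
  have hprod : ∫ ω, (n : ℂ)⁻¹ * (∑ j, S ω (.inr j) (.inr j)) *
      ((n : ℂ)⁻¹ * ∑ i, S ω (.inl i) (c i)) ∂P =
      (n : ℂ)⁻¹ * (n : ℂ)⁻¹ *
        ∑ i, ∑ j, ∫ ω, S ω (.inr j) (.inr j) * S ω (.inl i) (c i) ∂P := by
    rw [← Finset.sum_congr rfl fun i _ => integral_finsetSum _ fun j _ => hSSi _ _ _ _,
      ← integral_finsetSum _ fun i _ => integrable_finsetSum _ fun j _ => hSSi _ _ _ _,
      ← integral_const_mul]
    refine integral_congr_ae (.of_forall fun ω => ?_)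
    simp only [← Finset.sum_mul, ← Finset.mul_sum]
    ring
  have hpairI : ‖∑ i, ∑ j, ∫ ω, S ω (.inr j) (.inl i) * S ω (.inr j) (c i) ∂P‖ ≤ n / η ^ 2 := by
    rw [← Finset.sum_congr rfl fun i _ => integral_finsetSum _ fun j _ => hSSi _ _ _ _,
      ← integral_finsetSum _ fun i _ => integrable_finsetSum _ fun j _ => hSSi _ _ _ _]
    have h := norm_integral_le_of_norm_le_const (μ := P) (.of_forall hpair)
    simpa using h
  have hsum : ‖∑ i : Fin n, ∑ j : Fin n, ((∫ ω, Y i j ω * S ω (.inr j) (c i) ∂P) -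
      (δ : ℂ) * ((∫ ω, S ω (.inr j) (.inr j) * S ω (.inl i) (c i) ∂P) -
        (∫ ω, Y 0 0 ω ^ 2 ∂P) * ∫ ω, S ω (.inr j) (.inl i) * S ω (.inr j) (c i) ∂P))‖ ≤
      n * (n * ((8 * K ^ 3 + 4 * K) / η ^ 3 * δ ^ 2)) := by
    refine (norm_sum_le _ _).trans ?_
    calc _ ≤ ∑ _i : Fin n, (n * ((8 * K ^ 3 + 4 * K) / η ^ 3 * δ ^ 2)) := by
          refine Finset.sum_le_sum fun i _ => (norm_sum_le _ _).trans ?_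
          refine (Finset.sum_le_sum fun j _ => hmain i j).trans ?_
          simp
      _ = _ := by simp
  simp only [Finset.sum_sub_distrib, ← Finset.mul_sum] at hsum
  rw [hprod]
  generalize (∑ i, ∑ j, ∫ ω, S ω (.inr j) (.inl i) * S ω (.inr j) (c i) ∂P) = Q at *
  generalize (∑ i, ∑ j, ∫ ω, S ω (.inr j) (.inr j) * S ω (.inl i) (c i) ∂P) = R at *
  generalize (∑ i : Fin n, ∑ j : Fin n, ∫ ω, Y i j ω * S ω (.inr j) (c i) ∂P) = V at *
  generalize (∫ ω, Y 0 0 ω ^ 2 ∂P) = κ at *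
  rw [← hInt]
  -- Subtracting the integrated row equation leaves the summed expansion error, of size `n⁻¹ δ · n²
  -- δ² = δ`, and the term in `E Y²`, of size `δ² ≤ δ`.
  have hfin : ∀ x y : ℂ, x + (n : ℂ)⁻¹ * (n : ℂ)⁻¹ * R - y - (x + (n : ℂ)⁻¹ * δ * V - y) =
      -((n : ℂ)⁻¹ * δ * (V - δ * (R - κ * Q))) + (n : ℂ)⁻¹ * δ ^ 2 * (κ * Q) := fun x y => by
    rw [show (n : ℂ)⁻¹ * (n : ℂ)⁻¹ = (n : ℂ)⁻¹ * δ ^ 2 by rw [hδ2C]]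
    ring
  rw [hfin]
  refine (norm_add_le _ _).trans ?_
  simp only [norm_neg, norm_mul, norm_inv, norm_pow, Complex.norm_natCast, Complex.norm_real,
    Real.norm_of_nonneg hδ0]
  have h1 : (n : ℝ)⁻¹ * δ * ‖V - δ * (R - κ * Q)‖ ≤ (8 * K ^ 3 + 4 * K) / η ^ 3 * δ := by
    calc _ ≤ (n : ℝ)⁻¹ * δ * (n * (n * ((8 * K ^ 3 + 4 * K) / η ^ 3 * δ ^ 2))) := by gcongr
      _ = _ := by rw [hδ2]; field_simp
  have h2 : (n : ℝ)⁻¹ * δ ^ 2 * (‖κ‖ * ‖Q‖) ≤ K ^ 2 / η ^ 2 * δ := by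
    calc _ ≤ (n : ℝ)⁻¹ * δ ^ 2 * (K ^ 2 * (n / η ^ 2)) := by gcongr
      _ = K ^ 2 / η ^ 2 * (δ * δ) := by field_simp
      _ ≤ K ^ 2 / η ^ 2 * (δ * 1) := by gcongr
      _ = _ := by ring
  linarith

end IsBoundedTable

/-! ### The limit equation and its stability -/

/-- The limit `μ` of the normalized resolvent traces is characterized by `limitEquation z η μ = 1`. -/
def limitEquation (z : ℂ) (η x : ℝ) : ℝ := x * (η + x) + ‖z‖ ^ 2 * (x / (η + x))

/-- The summands `x²` and `x / (η + x)` are increasing on `[0, ∞)` and `η x` has slope `η`.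
Uniqueness of the root and Lipschitz stability with constant `1 / η` both follow. -/
lemma mul_sub_le_limitEquation_sub (z : ℂ) {η x y : ℝ} (hη : 0 < η) (hx : 0 ≤ x) (hxy : x ≤ y) :
    η * (y - x) ≤ limitEquation z η y - limitEquation z η x := by
  have h1 : x / (η + x) ≤ y / (η + y) := by
    rw [div_le_div_iff₀ (by positivity) (by linarith)]
    nlinarith
  have h2 : ‖z‖ ^ 2 * (x / (η + x)) ≤ ‖z‖ ^ 2 * (y / (η + y)) := by gcongr
  have h3 : 0 ≤ (y - x) * (y + x) := mul_nonneg (by linarith) (by linarith)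
  unfold limitEquation
  nlinarith

lemma mul_abs_sub_le_abs_limitEquation_sub (z : ℂ) {η x y : ℝ} (hη : 0 < η) (hx : 0 ≤ x)
    (hy : 0 ≤ y) : η * |y - x| ≤ |limitEquation z η y - limitEquation z η x| := by
  rcases le_total x y with h | h
  · rw [abs_of_nonneg (by linarith : 0 ≤ y - x)]
    exact (mul_sub_le_limitEquation_sub z hη hx h).trans (le_abs_self _)
  · rw [abs_sub_comm y x, abs_sub_comm (limitEquation z η y), abs_of_nonneg (by linarith)]
    exact (mul_sub_le_limitEquation_sub z hη hy h).trans (le_abs_self _)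

lemma exists_limitEquation_eq_one (z : ℂ) {η : ℝ} (hη : 0 < η) :
    ∃ x, 0 ≤ x ∧ limitEquation z η x = 1 := by
  have hc : ContinuousOn (limitEquation z η) (Set.Icc 0 (1 / η)) := by
    unfold limitEquation
    refine ContinuousOn.add (by fun_prop) (ContinuousOn.mul (by fun_prop) ?_)
    exact ContinuousOn.div (by fun_prop) (by fun_prop) fun x hx => by linarith [hx.1]
  have h0 : limitEquation z η 0 = 0 := by simp [limitEquation]
  have h1 : 1 ≤ limitEquation z η (1 / η) := by
    have := mul_sub_le_limitEquation_sub z hη le_rfl (by positivity : 0 ≤ 1 / η)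
    rw [h0] at this
    have h2 : η * (1 / η - 0) = 1 := by field_simp; simp
    linarith
  obtain ⟨x, hx, hx1⟩ := intermediate_value_Icc (by positivity : (0 : ℝ) ≤ 1 / η) hc
    (show (1 : ℝ) ∈ Set.Icc _ _ from ⟨by rw [h0]; exact zero_le_one, h1⟩)
  exact ⟨x, hx.1, hx1⟩

open Classical in
/-- The limit of the normalized resolvent traces. -/
def limitMean (z : ℂ) (η : ℝ) : ℝ :=
  if hη : 0 < η then (exists_limitEquation_eq_one z hη).choose else 0

lemma limitMean_nonneg (z : ℂ) {η : ℝ} (hη : 0 < η) : 0 ≤ limitMean z η := by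
  rw [limitMean, dif_pos hη]; exact (exists_limitEquation_eq_one z hη).choose_spec.1

lemma limitEquation_limitMean (z : ℂ) {η : ℝ} (hη : 0 < η) :
    limitEquation z η (limitMean z η) = 1 := by
  rw [limitMean, dif_pos hη]; exact (exists_limitEquation_eq_one z hη).choose_spec.2

/-- Stability of the limit equation, in the form in which the Schwinger–Dyson equations give it. -/
lemma abs_sub_limitMean_le (z : ℂ) {η x ε : ℝ} (hη : 0 < η) (hx : 0 ≤ x) {w : ℂ}
    (h1 : ‖(η : ℂ) * x + x * x + z * star w - 1‖ ≤ ε)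
    (h2 : ‖(η : ℂ) * w + x * w - z * x‖ ≤ ε) :
    |x - limitMean z η| ≤ ε * (1 + ‖z‖ / η) / η := by
  have hpos : 0 < η + x := by linarith
  have hε : 0 ≤ ε := (norm_nonneg _).trans h1
  have hC : ((η : ℂ) + x) ≠ 0 := by exact_mod_cast hpos.ne'
  -- Elimination of `w`: the conjugate of the second defect, times `z / (η + x)`, replaces `z w̄` by
  -- `|z|² x / (η + x)` in the first.
  have key : ((limitEquation z η x - 1 : ℝ) : ℂ) = ((η : ℂ) * x + x * x + z * star w - 1) -
      z * star ((η : ℂ) * w + x * w - z * x) / (η + x) := by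
    have h3 : ((‖z‖ ^ 2 : ℝ) : ℂ) = z * star z := by
      rw [Complex.star_def, Complex.mul_conj']; norm_cast
    have h4 : star ((η : ℂ) * w + x * w - z * x) = η * star w + x * star w - star z * x := by
      simp
    rw [limitEquation, h4, Complex.ofReal_sub, Complex.ofReal_add, Complex.ofReal_mul,
      Complex.ofReal_mul (‖z‖ ^ 2), h3]
    push_cast
    field_simp
    ring
  have h5 : |limitEquation z η x - 1| ≤ ε * (1 + ‖z‖ / η) := by
    rw [← Real.norm_eq_abs, ← Complex.norm_real, key]
    refine (norm_sub_le _ _).trans ?_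
    rw [norm_div, norm_mul, norm_star, ← Complex.ofReal_add, Complex.norm_real,
      Real.norm_of_nonneg hpos.le]
    calc _ ≤ ε + ‖z‖ * ε / η := by gcongr; linarith
      _ = _ := by ring
  rw [le_div_iff₀ hη, mul_comm]
  have h6 := mul_abs_sub_le_abs_limitEquation_sub z hη (limitMean_nonneg z hη) hx
  rw [limitEquation_limitMean z hη] at h6
  exact h6.trans h5

/-! ### Borel–Cantelli -/

section BorelCantelli

variable {Ω : Type*} [MeasurableSpace Ω] {P : Measure Ω} [IsFiniteMeasure P]

/-- Almost sure convergence from summable tails. -/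
lemma ae_tendsto_zero_of_summable {Z : ℕ → Ω → ℝ}
    (h : ∀ ε > 0, Summable fun n => P.real {ω | ε ≤ |Z n ω|}) :
    ∀ᵐ ω ∂P, Tendsto (fun n => Z n ω) atTop (𝓝 0) := by
  have hk : ∀ k : ℕ, ∀ᵐ ω ∂P, ∀ᶠ n in atTop, |Z n ω| < 1 / ((k : ℝ) + 1) := fun k => by
    have hs : ∑' n, P {ω | 1 / ((k : ℝ) + 1) ≤ |Z n ω|} ≠ ⊤ := by
      have := (h (1 / ((k : ℝ) + 1)) (by positivity)).tsum_ofReal_ne_top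
      rwa [tsum_congr fun n => ofReal_measureReal (measure_ne_top P _)] at this
    filter_upwards [ae_eventually_notMem hs] with ω hω
    filter_upwards [hω] with n hn
    simpa using hn
  filter_upwards [ae_all_iff.2 hk] with ω hω
  rw [Metric.tendsto_atTop']
  intro ε hε
  obtain ⟨k, hk⟩ := exists_nat_one_div_lt hε
  obtain ⟨N, hN⟩ := eventually_atTop.1 (hω k)
  exact ⟨N, fun n hn => by
    rw [Real.dist_eq, sub_zero]; exact (hN n hn.le).trans hk⟩

end BorelCantelli

/-! ### Concentration and convergence for bounded entries -/

namespace IsBoundedTable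

variable {Ω : Type*} [MeasurableSpace Ω] {P : Measure Ω} {Y : ℕ → ℕ → Ω → ℂ} {K : ℝ} {η : ℝ}

lemma continuous_resolventMean {ι : Type*} [Fintype ι] [DecidableEq ι] (hη : 0 < η) :
    Continuous (resolventMean (ι := ι) η) := by
  unfold resolventMean
  refine continuous_const.mul (continuous_finsetSum _ fun i _ => ?_)
  exact Complex.continuous_re.comp ((continuous_skewResolvent hη).matrix_elem _ _)

lemma measurable_resolventMean (hY : IsBoundedTable P Y K) (hη : 0 < η) (z : ℂ) (n : ℕ) :
    Measurable fun ω => resolventMean η (shiftedMatrix Y z n ω) := by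
  simp only [shiftedMatrix_eq_entryMatrix]
  exact (((continuous_resolventMean hη).comp (continuous_entryMatrix z)).measurable).comp
    (hY.measurable_entries n)

variable [IsProbabilityMeasure P]

/-- Exponential concentration of the normalized resolvent trace. -/
lemma measureReal_resolventMean_sub_integral_ge_le (hY : IsBoundedTable P Y K) (hη : 0 < η) (z : ℂ)
    {n : ℕ} [NeZero n] {ε : ℝ} (hε : 0 < ε) :
    P.real {ω | ε ≤ |resolventMean η (shiftedMatrix Y z n ω) -
      ∫ ω', resolventMean η (shiftedMatrix Y z n ω') ∂P|} ≤
      2 * Real.exp (n * -(ε ^ 2 * η ^ 4 / (8 * (K + 1) ^ 2))) := by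
  have hn0 : (0 : ℝ) < n := by exact_mod_cast Nat.pos_of_ne_zero (NeZero.ne n)
  have hK := hY.nonneg
  -- McDiarmid's inequality asks for bounded differences at all arguments, not only at values of the
  -- table. Clipping at `K` ensures this and leaves the entries of `Y` unchanged.
  let clip : ℂ → ℂ := fun x => if ‖x‖ ≤ K then x else 0
  have hclipm : Measurable clip :=
    Measurable.ite (measurableSet_le measurable_norm measurable_const) measurable_id
      measurable_const
  have hclip : ∀ x, ‖clip x‖ ≤ K := fun x => by
    by_cases h : ‖x‖ ≤ K <;> simp [clip, h, hK]
  have hclipY : ∀ i j ω, clip (Y i j ω) = Y i j ω := fun i j ω => by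
    simp [clip, hY.norm_le i j ω]
  let f : (Fin n × Fin n → ℂ) → ℝ := fun y => resolventMean η (entryMatrix z (clip ∘ y))
  have hfm : Measurable f :=
    (((continuous_resolventMean hη).comp (continuous_entryMatrix z)).measurable).comp
      (measurable_pi_lambda _ fun p => hclipm.comp (measurable_pi_apply p))
  -- A clipped entry moves by at most `2K`; using `K + 1` keeps the constant positive. Then `n² c² =
  -- 4 (K + 1)² / (n η⁴)`, which produces the exponent linear in `n`.
  let c : NNReal := ⟨(√n)⁻¹ * (2 * (K + 1)) / η ^ 2 / n, by positivity⟩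
  have hfc : ∀ y p a, |f (Function.update y p a) - f y| ≤ c := fun y p a => by
    have h := abs_resolventMean_sub_le_of_single hη
      (entryMatrix_update z (clip ∘ y) p (clip a))
    rw [← Function.comp_update, Fintype.card_fin] at h
    refine h.trans ?_
    change _ ≤ (√n)⁻¹ * (2 * (K + 1)) / η ^ 2 / n
    rw [norm_mul, norm_inv_sqrt_natCast]
    gcongr
    refine (norm_sub_le _ _).trans ?_
    have := hclip a
    have := hclip (y p)
    simp only [Function.comp_apply]
    linarith
  have := Measure.isProbabilityMeasure_map (μ := P) (hY.measurable 0 0).aemeasurable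
  have hmc := measureReal_abs_sub_integral_ge_le (P := P)
    (X := fun p : Fin n × Fin n => Y p.1 p.2) (fun p => hY.measurable _ _) (hY.indep_corner n)
    (μ := P.map (Y 0 0)) (fun p => (hY.identDistrib p.1 p.2).map_eq) c f hfm
    (fun y => abs_resolventMean_le _ hη) hfc hε.le
  have hf : ∀ ω, f (fun p => Y p.1 p.2 ω) = resolventMean η (shiftedMatrix Y z n ω) := fun ω => by
    simp only [f, Function.comp_def, hclipY, shiftedMatrix_eq_entryMatrix]
  simp only [hf] at hmc
  refine hmc.trans (le_of_eq ?_)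
  congr 2
  have hc : (c : ℝ) = (√n)⁻¹ * (2 * (K + 1)) / η ^ 2 / n := rfl
  rw [hc, Fintype.card_prod, Fintype.card_fin, div_pow, div_pow, mul_pow, inv_pow,
    Real.sq_sqrt hn0.le]
  push_cast
  field_simp
  ring

/-- The normalized resolvent trace concentrates around its mean. -/
lemma ae_tendsto_resolventMean_sub_integral (hY : IsBoundedTable P Y K) (hη : 0 < η) (z : ℂ) :
    ∀ᵐ ω ∂P, Tendsto (fun n : ℕ => resolventMean η (shiftedMatrix Y z (n + 1) ω) -
      ∫ ω', resolventMean η (shiftedMatrix Y z (n + 1) ω') ∂P) atTop (𝓝 0) := by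
  refine ae_tendsto_zero_of_summable fun ε hε => ?_
  have hK := hY.nonneg
  have hsum : Summable fun n : ℕ => 2 * Real.exp (n * -(ε ^ 2 * η ^ 4 / (8 * (K + 1) ^ 2))) := by
    refine (Real.summable_exp_nat_mul_iff.2 ?_).mul_left 2
    rw [neg_lt_zero]
    positivity
  refine Summable.of_nonneg_of_le (fun n => measureReal_nonneg) (fun n => ?_)
    ((summable_nat_add_iff 1).2 hsum)
  exact hY.measureReal_resolventMean_sub_integral_ge_le hη z hε

/-- The mean of the normalized resolvent trace is close to `limitMean z η` if the trace
concentrates. -/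
lemma abs_integral_resolventMean_sub_limitMean_le (hY : IsBoundedTable P Y K) (hη : 0 < η) (z : ℂ)
    {n : ℕ} [NeZero n] :
    |(∫ ω, resolventMean η (shiftedMatrix Y z n ω) ∂P) - limitMean z η| ≤
      (((8 * K ^ 3 + 4 * K) / η ^ 3 + K ^ 2 / η ^ 2) * (√n)⁻¹ +
        (∫ ω, |resolventMean η (shiftedMatrix Y z n ω) -
          ∫ ω', resolventMean η (shiftedMatrix Y z n ω') ∂P| ∂P) * (1 / η)) *
        (1 + ‖z‖ / η) / η := by
  have hnC : (n : ℂ) ≠ 0 := by exact_mod_cast NeZero.ne n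
  set C := ((8 * K ^ 3 + 4 * K) / η ^ 3 + K ^ 2 / η ^ 2) * (√n)⁻¹ with hC
  set m : Ω → ℝ := fun ω => resolventMean η (shiftedMatrix Y z n ω) with hm
  set μ := ∫ ω, m ω ∂P with hμ
  set V := ∫ ω, |m ω - μ| ∂P with hV
  have hmm : Measurable m := hY.measurable_resolventMean hη z n
  have hmi : Integrable m P :=
    .of_bound hmm.aestronglyMeasurable (1 / η) (.of_forall fun ω => abs_resolventMean_le _ hη)
  have hμC : ∫ ω, (m ω : ℂ) ∂P = μ := integral_complex_ofReal
  have hVi : Integrable (fun ω => |m ω - μ|) P := (hmi.sub (integrable_const μ)).abs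
  -- decorrelation
  have hdec : ∀ {a : Ω → ℂ}, Measurable a → (∀ ω, ‖a ω‖ ≤ 1 / η) →
      ‖(∫ ω, (m ω : ℂ) * a ω ∂P) - μ * ∫ ω, a ω ∂P‖ ≤ V * (1 / η) := fun {a} ha hab => by
    have hai : Integrable a P := .of_bound ha.aestronglyMeasurable _ (.of_forall hab)
    have hmai : Integrable (fun ω => (m ω : ℂ) * a ω) P :=
      hai.bdd_mul (c := 1 / η) (Complex.measurable_ofReal.comp hmm).aestronglyMeasurable
        (.of_forall fun ω => by
          rw [Complex.norm_real]; exact abs_resolventMean_le _ hη)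
    rw [← integral_const_mul, ← integral_sub hmai (hai.const_mul _), hV, ← integral_mul_const]
    refine norm_integral_le_of_norm_le (hVi.mul_const _) (.of_forall fun ω => ?_)
    rw [← sub_mul, norm_mul, ← Complex.ofReal_sub, Complex.norm_real, Real.norm_eq_abs]
    exact mul_le_mul_of_nonneg_left (hab ω) (abs_nonneg _)
  have h1 := hY.norm_schwingerDyson_le (n := n) hη z Sum.inl_injective
  have h2 := hY.norm_schwingerDyson_le (n := n) hη z Sum.inr_injective
  obtain ⟨w, hw⟩ : ∃ w : Ω → ℂ, w = fun ω => (n : ℂ)⁻¹ *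
    ∑ i, skewResolvent η (shiftedMatrix Y z n ω) (.inl i) (.inr i) := ⟨_, rfl⟩
  have hwm : Measurable w := by
    rw [hw]
    exact (Finset.measurable_sum _ fun i _ => hY.measurable_resolvent hη z _ _).const_mul _
  have hwb : ∀ ω, ‖w ω‖ ≤ 1 / η := fun ω => by
    rw [hw]
    have := norm_inv_card_mul_sum_le (ι := Fin n) (by positivity : 0 ≤ 1 / η)
      fun i => norm_skewResolvent_entry_le (shiftedMatrix Y z n ω) hη (.inl i) (.inr i)
    rwa [Fintype.card_fin] at this
  have e1 : ∀ ω, (n : ℂ)⁻¹ * ∑ i, skewResolvent η (shiftedMatrix Y z n ω) (.inl i) (.inl i) =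
      m ω := fun ω => by rw [hm, ofReal_resolventMean, Fintype.card_fin]
  have e2 : ∀ ω, (n : ℂ)⁻¹ * ∑ i, skewResolvent η (shiftedMatrix Y z n ω) (.inr i) (.inr i) =
      m ω := fun ω => by rw [hm, ofReal_resolventMean_eq_inr _ hη, Fintype.card_fin]
  have e3 : ∀ ω, (n : ℂ)⁻¹ * ∑ i, skewResolvent η (shiftedMatrix Y z n ω) (.inr i) (.inl i) =
      -star (w ω) := fun ω => by
    have : ∀ i, skewResolvent η (shiftedMatrix Y z n ω) (.inr i) (.inl i) =
        -star (skewResolvent η (shiftedMatrix Y z n ω) (.inl i) (.inr i)) := fun i => by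
      rw [← star_star (skewResolvent η (shiftedMatrix Y z n ω) (.inr i) (.inl i)),
        star_skewResolvent_inr_inl, star_neg]
    simp [hw, this, Finset.sum_neg_distrib]
  have e4 : ∀ ω, (n : ℂ)⁻¹ * ∑ i, skewResolvent η (shiftedMatrix Y z n ω) (.inl i) (.inr i) =
      w ω := fun ω => by rw [hw]
  have hwstar : ∫ ω, -star (w ω) ∂P = -star (∫ ω, w ω ∂P) := by
    rw [integral_neg]
    congr 1
    exact integral_conj
  simp only [e1, e3, hμC, hwstar] at h1
  simp only [e2, e4, hμC] at h2
  have hd1 : (n : ℂ)⁻¹ * ∑ i : Fin n, (1 : Matrix (Fin n ⊕ Fin n) (Fin n ⊕ Fin n) ℂ)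
      (.inl i) (.inl i) = 1 := by simp [hnC]
  have hd2 : (n : ℂ)⁻¹ * ∑ i : Fin n, (1 : Matrix (Fin n ⊕ Fin n) (Fin n ⊕ Fin n) ℂ)
      (.inl i) (.inr i) = 0 := by simp
  rw [hd1] at h1
  rw [hd2] at h2
  have hD1 := hdec (a := fun ω => (m ω : ℂ)) (Complex.measurable_ofReal.comp hmm) fun ω => by
    rw [Complex.norm_real]; exact abs_resolventMean_le _ hη
  have hD2 := hdec hwm hwb
  rw [hμC] at hD1
  have hμ0 : 0 ≤ μ := integral_nonneg fun ω => resolventMean_nonneg _ hη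
  refine abs_sub_limitMean_le z hη hμ0 (w := ∫ ω, w ω ∂P) ?_ ?_
  · rw [show (η : ℂ) * μ + μ * μ + z * star (∫ ω, w ω ∂P) - 1 =
      (η * μ + (∫ ω, (m ω : ℂ) * (m ω : ℂ) ∂P) - z * -star (∫ ω, w ω ∂P) - 1) -
      ((∫ ω, (m ω : ℂ) * (m ω : ℂ) ∂P) - μ * μ) by ring]
    exact (norm_sub_le _ _).trans (add_le_add h1 hD1)
  · rw [show (η : ℂ) * (∫ ω, w ω ∂P) + μ * (∫ ω, w ω ∂P) - z * μ =
      (η * (∫ ω, w ω ∂P) + (∫ ω, (m ω : ℂ) * w ω ∂P) - z * μ - 0) -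
      ((∫ ω, (m ω : ℂ) * w ω ∂P) - μ * ∫ ω, w ω ∂P) by ring]
    exact (norm_sub_le _ _).trans (add_le_add h2 hD2)

/-- Convergence of the normalized resolvent traces for bounded entries. -/
lemma ae_tendsto_resolventMean (hY : IsBoundedTable P Y K) (hη : 0 < η) (z : ℂ) :
    ∀ᵐ ω ∂P, Tendsto (fun n : ℕ => resolventMean η (shiftedMatrix Y z (n + 1) ω)) atTop
      (𝓝 (limitMean z η)) := by
  have hconc := hY.ae_tendsto_resolventMean_sub_integral hη z
  have hb : ∀ n, |∫ ω', resolventMean η (shiftedMatrix Y z n ω') ∂P| ≤ 1 / η := fun n => by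
    have := norm_integral_le_of_norm_le_const (μ := P) (C := 1 / η)
      (f := fun ω' => resolventMean η (shiftedMatrix Y z n ω'))
      (.of_forall fun ω => abs_resolventMean_le _ hη)
    simpa using this
  -- Concentration serves twice: almost surely at the end, and here in `L¹`, by dominated
  -- convergence, to decorrelate the products in the Schwinger–Dyson equations.
  have hV : Tendsto (fun n : ℕ => ∫ ω, |resolventMean η (shiftedMatrix Y z (n + 1) ω) -
      ∫ ω', resolventMean η (shiftedMatrix Y z (n + 1) ω') ∂P| ∂P) atTop (𝓝 0) := by
    have h := tendsto_integral_of_dominated_convergence (μ := P)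
      (F := fun n ω => |resolventMean η (shiftedMatrix Y z (n + 1) ω) -
        ∫ ω', resolventMean η (shiftedMatrix Y z (n + 1) ω') ∂P|) (f := fun _ => 0)
      (fun _ => 1 / η + 1 / η)
      (fun n => (((hY.measurable_resolventMean hη z (n + 1)).sub_const _).abs).aestronglyMeasurable)
      (integrable_const _)
      (fun n => .of_forall fun ω => by
        rw [Real.norm_eq_abs, abs_abs]
        exact (abs_sub _ _).trans (add_le_add (abs_resolventMean_le _ hη) (hb _)))
      (by
        filter_upwards [hconc] with ω hω
        simpa using hω.abs)
    simpa using h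
  have hδ : Tendsto (fun n : ℕ => (√((n + 1 : ℕ) : ℝ))⁻¹) atTop (𝓝 0) :=
    tendsto_inv_atTop_zero.comp (Real.tendsto_sqrt_atTop.comp
      (tendsto_natCast_atTop_atTop.comp (tendsto_add_atTop_nat 1)))
  have hmean : Tendsto (fun n : ℕ => (∫ ω, resolventMean η (shiftedMatrix Y z (n + 1) ω) ∂P) -
      limitMean z η) atTop (𝓝 0) := by
    refine squeeze_zero_norm (fun n =>
      hY.abs_integral_resolventMean_sub_limitMean_le hη z (n := n + 1)) ?_
    have h := ((((hδ.const_mul ((8 * K ^ 3 + 4 * K) / η ^ 3 + K ^ 2 / η ^ 2)).add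
      (hV.mul_const (1 / η))).mul_const (1 + ‖z‖ / η)).div_const η)
    simpa using h
  filter_upwards [hconc] with ω hω
  have h := (hω.add hmean).add_const (limitMean z η)
  simpa using h

end IsBoundedTable

/-- Sums over a square corner of a table, along the enumeration of `ℕ × ℕ` by `Nat.unpair`. -/
lemma sum_range_sq_unpair (f : ℕ → ℕ → ℝ) (n : ℕ) :
    ∑ k ∈ Finset.range (n ^ 2), f k.unpair.1 k.unpair.2 = ∑ i : Fin n, ∑ j : Fin n, f i j := by
  have h1 : ∑ i : Fin n, ∑ j : Fin n, f i j =
      ∑ p ∈ Finset.range n ×ˢ Finset.range n, f p.1 p.2 := by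
    rw [Finset.sum_product, Finset.sum_range]
    exact Finset.sum_congr rfl fun i _ => (Finset.sum_range _).symm
  rw [h1]
  -- `Nat.pair` fills the quadrant by square shells, so the codes below `n²` are exactly the pairs
  -- with both components below `n`.
  refine Finset.sum_nbij' Nat.unpair (fun p => Nat.pair p.1 p.2) ?_ ?_ ?_ ?_ ?_
  · intro k hk
    rw [Finset.mem_range] at hk
    have h2 := Nat.max_sq_add_min_le_pair k.unpair.1 k.unpair.2
    rw [Nat.pair_unpair] at h2
    have h3 : max k.unpair.1 k.unpair.2 < n :=
      lt_of_pow_lt_pow_left₀ 2 (Nat.zero_le _) (lt_of_le_of_lt (le_of_add_le_left h2) hk)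
    simp only [Finset.mem_product, Finset.mem_range]
    exact max_lt_iff.1 h3
  · intro p hp
    simp only [Finset.mem_product, Finset.mem_range] at hp
    rw [Finset.mem_range]
    refine (Nat.pair_lt_max_add_one_sq p.1 p.2).trans_le ?_
    exact Nat.pow_le_pow_left (max_lt_iff.2 hp) 2
  · intro k _; simp
  · intro p _; simp
  · intro k _; rfl

/-! ### Truncation of the entries -/

section Truncation

variable {Ω : Type*} [MeasurableSpace Ω] {P : Measure Ω} [IsProbabilityMeasure P]

/-- Expansion of the square. It identifies the limit of the variances of the truncated variables as
`1`. -/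
lemma integral_sq_norm_sub_mean {Z : Ω → ℂ} (h2 : MemLp Z 2 P) :
    ∫ ω, ‖Z ω - ∫ ω', Z ω' ∂P‖ ^ 2 ∂P = (∫ ω, ‖Z ω‖ ^ 2 ∂P) - ‖∫ ω, Z ω ∂P‖ ^ 2 := by
  have hZ : Integrable Z P := h2.integrable (by norm_num)
  have hZ2 : Integrable (fun ω => ‖Z ω‖ ^ 2) P := h2.integrable_norm_pow (by norm_num)
  set a := ∫ ω', Z ω' ∂P with ha
  have h : ∀ ω, ‖Z ω - a‖ ^ 2 = ‖Z ω‖ ^ 2 - 2 * (Z ω * star a).re + ‖a‖ ^ 2 := fun ω => by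
    rw [← Complex.normSq_eq_norm_sq, Complex.normSq_sub, Complex.normSq_eq_norm_sq,
      Complex.normSq_eq_norm_sq, Complex.star_def]
    ring
  have hre : Integrable (fun ω => (Z ω * star a).re) P := (hZ.mul_const _).re
  have hre2 : ∫ ω, (Z ω * star a).re ∂P = ‖a‖ ^ 2 := by
    have h1 : ∫ ω, (Z ω * star a).re ∂P = (∫ ω, Z ω * star a ∂P).re :=
      integral_re (hZ.mul_const (star a))
    rw [h1, integral_mul_const, ← ha, Complex.star_def, Complex.mul_conj, Complex.ofReal_re,
      Complex.normSq_eq_norm_sq]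
  simp only [h]
  have hsub : Integrable (fun ω => ‖Z ω‖ ^ 2 - 2 * (Z ω * star a).re) P :=
    hZ2.sub (hre.const_mul 2)
  rw [integral_add hsub (integrable_const _),
    integral_sub hZ2 (hre.const_mul 2), integral_const_mul, hre2]
  simp
  ring

/-- A square integrable variable of unit variance is approximated, up to its mean, by bounded
functions of it that are centred of unit variance. -/
lemma exists_truncation {Z : Ω → ℂ} (hZm : Measurable Z) (h2 : MemLp Z 2 P)
    (hvar : (∫ ω, ‖Z ω‖ ^ 2 ∂P) - ‖∫ ω, Z ω ∂P‖ ^ 2 = 1) {ε : ℝ} (hε : 0 < ε) :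
    ∃ (φ : ℂ → ℂ) (K : ℝ), Measurable φ ∧ (∀ x, ‖φ x‖ ≤ K) ∧ ∫ ω, φ (Z ω) ∂P = 0 ∧
      ∫ ω, ‖φ (Z ω)‖ ^ 2 ∂P = 1 ∧
      Integrable (fun ω => ‖Z ω - (∫ ω', Z ω' ∂P) - φ (Z ω)‖ ^ 2) P ∧
      ∫ ω, ‖Z ω - (∫ ω', Z ω' ∂P) - φ (Z ω)‖ ^ 2 ∂P < ε := by
  have hZ : Integrable Z P := h2.integrable (by norm_num)
  set m := ∫ ω, Z ω ∂P with hm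
  set C := ∫ ω, ‖Z ω‖ ∂P with hC
  have hmC : ‖m‖ ≤ C := norm_integral_le_integral_norm _
  have hC0 : 0 ≤ C := (norm_nonneg _).trans hmC
  let τ : ℕ → ℂ → ℂ := fun K x => if ‖x‖ ≤ K then x else 0
  have hτm : ∀ K, Measurable (τ K) := fun K =>
    Measurable.ite (measurableSet_le measurable_norm measurable_const) measurable_id
      measurable_const
  have hτb : ∀ K x, ‖τ K x‖ ≤ K := fun K x => by
    by_cases h : ‖x‖ ≤ K <;> simp [τ, h]
  have hτle : ∀ K x, ‖τ K x‖ ≤ ‖x‖ := fun K x => by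
    by_cases h : ‖x‖ ≤ K <;> simp [τ, h]
  have hτlim : ∀ x, Tendsto (fun K => τ K x) atTop (𝓝 x) := fun x => by
    refine tendsto_const_nhds.congr' ?_
    obtain ⟨N, hN⟩ := exists_nat_ge ‖x‖
    filter_upwards [eventually_ge_atTop N] with K hK
    have : ‖x‖ ≤ K := hN.trans (by exact_mod_cast hK)
    simp [τ, this]
  let a : ℕ → ℂ := fun K => ∫ ω, τ K (Z ω) ∂P
  have haC : ∀ K, ‖a K‖ ≤ C := fun K =>
    norm_integral_le_of_norm_le hZ.norm (.of_forall fun ω => hτle K _)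
  have halim : Tendsto a atTop (𝓝 m) :=
    tendsto_integral_of_dominated_convergence (fun ω => ‖Z ω‖)
      (fun K => ((hτm K).comp hZm).aestronglyMeasurable) hZ.norm
      (fun K => .of_forall fun ω => hτle K _) (.of_forall fun ω => hτlim _)
  have hdom : Integrable (fun ω => (‖Z ω‖ + C) ^ 2) P := by
    have : MemLp (fun ω => ‖Z ω‖ + C) 2 P := h2.norm.add (memLp_const C)
    have := this.integrable_norm_pow (by norm_num)
    simpa using this
  let v : ℕ → ℝ := fun K => ∫ ω, ‖τ K (Z ω) - a K‖ ^ 2 ∂P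
  have hvlim : Tendsto v atTop (𝓝 1) := by
    rw [← hvar, ← integral_sq_norm_sub_mean h2]
    refine tendsto_integral_of_dominated_convergence (fun ω => (‖Z ω‖ + C) ^ 2)
      (fun K => ?_) hdom (fun K => .of_forall fun ω => ?_) (.of_forall fun ω => ?_)
    · exact ((((hτm K).comp hZm).sub_const _).norm.pow_const 2).aestronglyMeasurable
    · rw [Real.norm_eq_abs, abs_pow, abs_norm]
      exact pow_le_pow_left₀ (norm_nonneg _)
        ((norm_sub_le _ _).trans (add_le_add (hτle K _) (haC K))) 2
    · exact (((hτlim _).sub halim).norm.pow 2)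
  have hσlim : Tendsto (fun K => √(v K)) atTop (𝓝 1) := by
    have := (Real.continuous_sqrt.tendsto 1).comp hvlim
    rwa [Real.sqrt_one] at this
  -- Centring and rescaling restore mean zero and unit variance exactly; the corrections vanish
  -- because `a K → m` and `v K → 1`.
  let φ : ℕ → ℂ → ℂ := fun K x => ((√(v K) : ℝ) : ℂ)⁻¹ * (τ K x - a K)
  have hφm : ∀ K, Measurable (φ K) := fun K => ((hτm K).sub_const _).const_mul _
  have hmeas : ∀ K, Measurable fun ω => ‖Z ω - m - φ K (Z ω)‖ ^ 2 := fun K =>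
    (((hZm.sub_const m).sub ((hφm K).comp hZm)).norm).pow_const 2
  have hbound : ∀ K, 1 / 2 < √(v K) → ∀ ω,
      ‖‖Z ω - m - φ K (Z ω)‖ ^ 2‖ ≤ 9 * (‖Z ω‖ + C) ^ 2 := fun K hK ω => by
    have h1 : ‖φ K (Z ω)‖ ≤ 2 * (‖Z ω‖ + C) := by
      simp only [φ]
      rw [norm_mul, norm_inv, Complex.norm_real, Real.norm_of_nonneg (Real.sqrt_nonneg _)]
      have h3 : (√(v K))⁻¹ ≤ 2 := by
        rw [inv_le_comm₀ (by linarith) (by norm_num)]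
        linarith
      exact mul_le_mul h3 ((norm_sub_le _ _).trans (add_le_add (hτle K _) (haC K)))
        (norm_nonneg _) (by norm_num)
    have h3 : ‖Z ω - m - φ K (Z ω)‖ ≤ 3 * (‖Z ω‖ + C) := by
      refine (norm_sub_le _ _).trans ?_
      have := norm_sub_le (Z ω) m
      linarith
    rw [Real.norm_eq_abs, abs_pow, abs_norm]
    calc _ ≤ (3 * (‖Z ω‖ + C)) ^ 2 := pow_le_pow_left₀ (norm_nonneg _) h3 2
      _ = _ := by ring
  -- For small `K` the truncated variance may vanish. Once `√(v K) > 1 / 2` the normalizing factor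
  -- is below `2`, which yields the dominating function `9 (‖Z‖ + C)²`.
  have hev : ∀ᶠ K in atTop, 1 / 2 < √(v K) := hσlim.eventually (lt_mem_nhds (by norm_num))
  have hd : Tendsto (fun K => ∫ ω, ‖Z ω - m - φ K (Z ω)‖ ^ 2 ∂P) atTop (𝓝 0) := by
    have h := tendsto_integral_filter_of_dominated_convergence (μ := P) (l := atTop)
      (F := fun K ω => ‖Z ω - m - φ K (Z ω)‖ ^ 2) (f := fun _ => 0)
      (fun ω => 9 * (‖Z ω‖ + C) ^ 2) (.of_forall fun K => (hmeas K).aestronglyMeasurable)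
      (by filter_upwards [hev] with K hK using .of_forall (hbound K hK))
      (hdom.const_mul 9) (.of_forall fun ω => by
        have hσC : Tendsto (fun K => ((√(v K) : ℝ) : ℂ)⁻¹) atTop (𝓝 1) := by
          have h1 := (Complex.continuous_ofReal.tendsto 1).comp hσlim
          have h2 := h1.inv₀ (by simp)
          simpa using h2
        have h3 := ((tendsto_const_nhds (x := Z ω - m)).sub
          (hσC.mul ((hτlim (Z ω)).sub halim))).norm.pow 2
        simpa using h3)
    simpa using h
  obtain ⟨K, hK, hKd⟩ := (hev.and (hd.eventually (gt_mem_nhds hε))).exists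
  have hσ0 : 0 < √(v K) := by linarith
  have hσC : ((√(v K) : ℝ) : ℂ) ≠ 0 := by exact_mod_cast hσ0.ne'
  have hτi : Integrable (fun ω => τ K (Z ω)) P :=
    hZ.mono ((hτm K).comp hZm).aestronglyMeasurable (.of_forall fun ω => hτle K _)
  refine ⟨φ K, (√(v K))⁻¹ * (K + C), hφm K, fun x => ?_, ?_, ?_, ?_, hKd⟩
  · simp only [φ]
    rw [norm_mul, norm_inv, Complex.norm_real, Real.norm_of_nonneg (Real.sqrt_nonneg _)]
    exact mul_le_mul_of_nonneg_left ((norm_sub_le _ _).trans (add_le_add (hτb K _) (haC K)))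
      (by positivity)
  · simp only [φ]
    rw [integral_const_mul, integral_sub hτi (integrable_const _)]
    simp [a]
  · have h1 : ∀ ω, ‖φ K (Z ω)‖ ^ 2 = (v K)⁻¹ * ‖τ K (Z ω) - a K‖ ^ 2 := fun ω => by
      simp only [φ]
      rw [norm_mul, norm_inv, Complex.norm_real, Real.norm_of_nonneg (Real.sqrt_nonneg _), mul_pow,
        inv_pow, Real.sq_sqrt (Real.sqrt_pos.1 hσ0).le]
    simp only [h1]
    rw [integral_const_mul]
    exact inv_mul_cancel₀ (Real.sqrt_pos.1 hσ0).ne'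
  · exact (hdom.const_mul 9).mono' (hmeas K).aestronglyMeasurable (.of_forall (hbound K hK))

end Truncation

/-- Comparison of the resolvent traces of two tables that differ by a constant and a table that is
small in mean square. -/
lemma abs_resolventMean_sub_comp_le {Ω : Type*} {η : ℝ} (hη : 0 < η) (z : ℂ) (φ : ℂ → ℂ) (m : ℂ)
    {n : ℕ} [NeZero n] (X : ℕ → ℕ → Ω → ℂ) (ω : Ω) :
    |resolventMean η (shiftedMatrix X z n ω) -
      resolventMean η (shiftedMatrix (fun i j ω => φ (X i j ω)) z n ω)| ≤
      1 / η ^ 2 * √((∑ i : Fin n, ∑ j : Fin n, ‖X i j ω - m - φ (X i j ω)‖ ^ 2) / (n : ℝ) ^ 2) +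
        (√n)⁻¹ * ‖m‖ / η ^ 2 := by
  have hn0 : (0 : ℝ) < n := by exact_mod_cast Nat.pos_of_ne_zero (NeZero.ne n)
  set A := shiftedMatrix X z n ω with hA
  set B := shiftedMatrix (fun i j ω => φ (X i j ω)) z n ω with hB
  -- The intermediate matrix `D` differs from `A` by a table small in mean square, for the Frobenius
  -- bound, and from `B` by a constant, for the rank one bound.
  set D := shiftedMatrix (fun i j ω => φ (X i j ω) + m) z n ω with hD
  have h1 := abs_resolventMean_sub_le_frobenius A D hη
  have h2 := abs_resolventMean_sub_le_of_sub_const D B hη (c := ((√n : ℝ) : ℂ)⁻¹ * m)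
    (fun i j => by simp [hD, hB, shiftedMatrix, cornerMatrix]; ring)
  rw [norm_mul, norm_inv_sqrt_natCast] at h2
  have h3 : (∑ i, ∑ j, ‖A i j - D i j‖ ^ 2) / (Fintype.card (Fin n) : ℝ) =
      (∑ i : Fin n, ∑ j : Fin n, ‖X i j ω - m - φ (X i j ω)‖ ^ 2) / (n : ℝ) ^ 2 := by
    have : ∀ i j : Fin n, ‖A i j - D i j‖ ^ 2 = (n : ℝ)⁻¹ * ‖X i j ω - m - φ (X i j ω)‖ ^ 2 :=
      fun i j => by
        rw [show A i j - D i j = ((√n : ℝ) : ℂ)⁻¹ * (X i j ω - m - φ (X i j ω)) by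
          simp [hA, hD, shiftedMatrix, cornerMatrix]; ring, norm_mul, norm_inv_sqrt_natCast,
          mul_pow, inv_pow, Real.sq_sqrt hn0.le]
    simp only [this, ← Finset.mul_sum, Fintype.card_fin]
    field_simp
  rw [h3] at h1
  calc _ ≤ |resolventMean η A - resolventMean η D| + |resolventMean η D - resolventMean η B| :=
        abs_sub_le _ _ _
    _ ≤ _ := add_le_add h1 h2

/-! ### Law of large numbers and convergence of the traces for general entries -/

namespace IsIIDTableVarOne

variable {Ω : Type*} [MeasurableSpace Ω] {P : Measure Ω} {X : ℕ → ℕ → Ω → ℂ}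

/-- The strong law of large numbers for a table, along square corners. -/
lemma ae_tendsto_average (hX : IsIIDTableVarOne P X) {g : ℂ → ℝ} (hg : Measurable g)
    (hInt : Integrable (fun ω => g (X 0 0 ω)) P) :
    ∀ᵐ ω ∂P, Tendsto (fun n : ℕ => (∑ i : Fin n, ∑ j : Fin n, g (X i j ω)) / (n : ℝ) ^ 2) atTop
      (𝓝 (∫ ω, g (X 0 0 ω) ∂P)) := by
  -- Read along `Nat.unpair`, the table is an i.i.d. sequence, and the corner averages are its
  -- averages along the subsequence `n²`.
  let ξ : ℕ → Ω → ℝ := fun k ω => g (X k.unpair.1 k.unpair.2 ω)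
  have hinj : Function.Injective Nat.unpair := fun a b h => by
    rw [← Nat.pair_unpair a, ← Nat.pair_unpair b, h]
  have hi := (hX.indep.precomp hinj).comp (fun _ => g) (fun _ => hg)
  have h0 : ξ 0 = fun ω => g (X 0 0 ω) := by simp [ξ]
  have hsl := strong_law_ae_real ξ (by rw [h0]; exact hInt)
    (fun i j hij => hi.indepFun hij)
    (fun k => by
      rw [h0]
      exact (hX.identDistrib k.unpair.1 k.unpair.2).comp hg)
  rw [h0] at hsl
  filter_upwards [hsl] with ω hω
  have h := hω.comp (tendsto_pow_atTop (α := ℕ) (n := 2) (by norm_num))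
  refine h.congr fun n => ?_
  simp only [Function.comp_apply, ξ]
  rw [sum_range_sq_unpair (fun i j => g (X i j ω))]
  push_cast
  rfl

lemma isBoundedTable_comp (hX : IsIIDTableVarOne P X) {φ : ℂ → ℂ} {K : ℝ} (hφ : Measurable φ)
    (hK : ∀ x, ‖φ x‖ ≤ K) (h0 : ∫ ω, φ (X 0 0 ω) ∂P = 0) (h1 : ∫ ω, ‖φ (X 0 0 ω)‖ ^ 2 ∂P = 1) :
    IsBoundedTable P (fun i j ω => φ (X i j ω)) K where
  measurable i j := hφ.comp (hX.measurable i j)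
  indep := hX.indep.comp (fun _ => φ) fun _ => hφ
  identDistrib i j := (hX.identDistrib i j).comp hφ
  norm_le _ _ _ := hK _
  integral_eq_zero := h0
  integral_sq_eq_one := h1

/-- Convergence of the normalized resolvent traces. -/
theorem ae_tendsto_resolventMean [IsProbabilityMeasure P] (hX : IsIIDTableVarOne P X) {η : ℝ}
    (hη : 0 < η) (z : ℂ) :
    ∀ᵐ ω ∂P, Tendsto (fun n : ℕ => resolventMean η (shiftedMatrix X z (n + 1) ω)) atTop
      (𝓝 (limitMean z η)) := by
  -- The tolerance is a square because the Frobenius comparison takes a root. Countably many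
  -- truncation levels keep the exceptional set null.
  have htr := fun k : ℕ => exists_truncation (hX.measurable 0 0) hX.memLp hX.variance_eq_one
    (by positivity : 0 < (1 / ((k : ℝ) + 1)) ^ 2)
  choose φ K hφm hφb hφ0 hφ1 hφi hφε using htr
  set m := ∫ ω, X 0 0 ω ∂P with hm
  have hae1 : ∀ᵐ ω ∂P, ∀ k, Tendsto (fun n : ℕ =>
      resolventMean η (shiftedMatrix (fun i j ω => φ k (X i j ω)) z (n + 1) ω)) atTop
      (𝓝 (limitMean z η)) := ae_all_iff.2 fun k =>
    (hX.isBoundedTable_comp (hφm k) (hφb k) (hφ0 k) (hφ1 k)).ae_tendsto_resolventMean hη z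
  have hae2 := ae_all_iff.2 fun k => hX.ae_tendsto_average (g := fun x => ‖x - m - φ k x‖ ^ 2)
    (((measurable_id.sub_const m).sub (hφm k)).norm.pow_const 2) (hφi k)
  filter_upwards [hae1, hae2] with ω h1 h2
  rw [Metric.tendsto_atTop']
  intro ε hε
  obtain ⟨k, hk⟩ := exists_nat_one_div_lt (by positivity : 0 < ε * η ^ 2)
  have hδ : Tendsto (fun n : ℕ => (√((n + 1 : ℕ) : ℝ))⁻¹) atTop (𝓝 0) :=
    tendsto_inv_atTop_zero.comp (Real.tendsto_sqrt_atTop.comp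
      (tendsto_natCast_atTop_atTop.comp (tendsto_add_atTop_nat 1)))
  have hlim : Tendsto (fun n : ℕ => 1 / η ^ 2 * √((∑ i : Fin (n + 1), ∑ j : Fin (n + 1),
      ‖X i j ω - m - φ k (X i j ω)‖ ^ 2) / ((n + 1 : ℕ) : ℝ) ^ 2) +
        (√((n + 1 : ℕ) : ℝ))⁻¹ * ‖m‖ / η ^ 2 +
        |resolventMean η (shiftedMatrix (fun i j ω => φ k (X i j ω)) z (n + 1) ω) -
          limitMean z η|) atTop
      (𝓝 (1 / η ^ 2 * √(∫ ω, ‖X 0 0 ω - m - φ k (X 0 0 ω)‖ ^ 2 ∂P) + 0 * ‖m‖ / η ^ 2 +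
        |limitMean z η - limitMean z η|)) :=
    ((((Real.continuous_sqrt.tendsto _).comp
      ((h2 k).comp (tendsto_add_atTop_nat 1))).const_mul _).add
      ((hδ.mul_const _).div_const _)).add ((h1 k).sub_const _).abs
  have hlt : 1 / η ^ 2 * √(∫ ω, ‖X 0 0 ω - m - φ k (X 0 0 ω)‖ ^ 2 ∂P) + 0 * ‖m‖ / η ^ 2 +
        |limitMean z η - limitMean z η| < ε := by
    rw [sub_self, abs_zero, zero_mul, zero_div, add_zero, add_zero]
    have h3 : √(∫ ω, ‖X 0 0 ω - m - φ k (X 0 0 ω)‖ ^ 2 ∂P) ≤ 1 / ((k : ℝ) + 1) := by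
      rw [← Real.sqrt_sq (by positivity : 0 ≤ 1 / ((k : ℝ) + 1))]
      exact Real.sqrt_le_sqrt (hφε k).le
    rw [one_div, inv_mul_lt_iff₀ (by positivity), mul_comm]
    exact h3.trans_lt hk
  obtain ⟨N, hN⟩ := eventually_atTop.1 (hlim.eventually (gt_mem_nhds hlt))
  refine ⟨N, fun n hn => lt_of_le_of_lt ?_ (hN n hn.le)⟩
  rw [Real.dist_eq]
  refine (abs_sub_le _ (resolventMean η (shiftedMatrix (fun i j ω => φ k (X i j ω)) z (n + 1) ω))
    _).trans ?_
  gcongr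
  exact abs_resolventMean_sub_comp_le hη z (φ k) m X ω

end IsIIDTableVarOne

/-! ### The resolvent trace in terms of singular values -/

section SingularValues

open scoped Matrix InnerProductSpace

variable {n : ℕ} (A : Matrix (Fin n) (Fin n) ℂ)

lemma Matrix.trace_toEuclideanLin (B : Matrix (Fin n) (Fin n) ℂ) :
    LinearMap.trace ℂ _ (Matrix.toEuclideanLin B) = B.trace := by
  rw [LinearMap.trace_eq_sum_inner _ (EuclideanSpace.basisFun (Fin n) ℂ)]
  refine Finset.sum_congr rfl fun i _ => ?_
  simp [EuclideanSpace.inner_single_left, Matrix.toLpLin_apply]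

/-- The sum of the squares of the singular values is the square of the Frobenius norm. -/
lemma Matrix.sum_sq_singularValue :
    ∑ k, A.singularValue k ^ 2 = ∑ i, ∑ j, ‖A i j‖ ^ 2 := by
  have hn : Module.finrank ℂ (EuclideanSpace ℂ (Fin n)) = n := by simp
  have h1 := (Matrix.toEuclideanLin A).isSymmetric_adjoint_comp_self.re_trace_eq_sum_eigenvalues hn
  simp only [Matrix.singularValue, LinearMap.sq_singularValues_fin _ hn]
  rw [← h1, ← Matrix.toEuclideanLin_conjTranspose_eq_adjoint, ← Matrix.toLpLin_mul_same,
    Matrix.trace_toEuclideanLin]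
  simp only [Matrix.trace, Matrix.diag_apply, Matrix.mul_apply, Matrix.conjTranspose_apply]
  rw [Finset.sum_comm]
  simp [Complex.conj_mul', ← Complex.ofReal_pow]

/-- The lower right block of the resolvent is `η (Aᴴ A + η²)⁻¹`. -/
lemma skewResolvent_toBlocks₂₂ {η : ℝ} (hη : 0 < η) :
    Aᴴ * A * (skewResolvent η A).toBlocks₂₂ + (η : ℂ) ^ 2 • (skewResolvent η A).toBlocks₂₂ =
      (η : ℂ) • 1 := by
  have h := skewBlock_mul_skewResolvent A hη
  rw [← Matrix.fromBlocks_toBlocks (skewResolvent η A), skewBlock, Matrix.fromBlocks_multiply,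
    ← Matrix.fromBlocks_one, Matrix.fromBlocks_inj] at h
  obtain ⟨-, h12, -, h22⟩ := h
  simp only [Matrix.smul_mul, one_mul, Matrix.neg_mul] at h12 h22
  -- The second block column of `M S = 1` reads `η S₁₂ + A S₂₂ = 0` and `-Aᴴ S₁₂ + η S₂₂ = 1`;
  -- multiplying the latter by `η` eliminates `S₁₂`.
  rw [← h22, smul_add, smul_neg, smul_smul, ← pow_two, Matrix.mul_assoc,
    ← Matrix.mul_smul, eq_neg_of_add_eq_zero_left h12]
  simp

/-- The normalized resolvent trace in terms of the singular values. -/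
lemma resolventMean_eq_sum_singularValue {η : ℝ} (hη : 0 < η) :
    resolventMean η A = (n : ℝ)⁻¹ * ∑ k, η * (A.singularValue k ^ 2 + η ^ 2)⁻¹ := by
  have hn : Module.finrank ℂ (EuclideanSpace ℂ (Fin n)) = n := by simp
  set T := Matrix.toEuclideanLin A with hT
  have hsym := T.isSymmetric_adjoint_comp_self
  set b := hsym.eigenvectorBasis hn with hb
  set L := Matrix.toEuclideanLin (skewResolvent η A).toBlocks₂₂ with hL
  have hLeq : ∀ x, (T.adjoint ∘ₗ T) (L x) + (η : ℂ) ^ 2 • L x = (η : ℂ) • x := fun x => by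
    have h := congrArg (fun B => Matrix.toEuclideanLin B x) (skewResolvent_toBlocks₂₂ A hη)
    simp only [map_add, map_smul, Matrix.toLpLin_mul_same, LinearMap.add_apply,
      LinearMap.smul_apply, Matrix.toLpLin_one, LinearMap.id_apply] at h
    rw [hT, ← Matrix.toEuclideanLin_conjTranspose_eq_adjoint]
    exact h
  have hinner : ∀ k, ⟪b k, L (b k)⟫_ℂ = ((η * (A.singularValue k ^ 2 + η ^ 2)⁻¹ : ℝ) : ℂ) := by
    intro k
    -- Moving `T* T` onto its eigenvector `b k` gives `(s_k² + η²) ⟪b k, L (b k)⟫ = η`.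
    have h := congrArg (fun x => ⟪b k, x⟫_ℂ) (hLeq (b k))
    simp only [inner_add_right, inner_smul_right] at h
    rw [← hsym (b k) (L (b k)), hsym.apply_eigenvectorBasis hn k, inner_smul_left,
      ← LinearMap.sq_singularValues_fin T hn k] at h
    have h1 : ⟪b k, b k⟫_ℂ = 1 := by
      rw [inner_self_eq_norm_sq_to_K, b.orthonormal.1 k]; simp
    rw [h1] at h
    change _ = ((η * ((T.singularValues k) ^ 2 + η ^ 2)⁻¹ : ℝ) : ℂ)
    have hpos : (0 : ℝ) < (T.singularValues k) ^ 2 + η ^ 2 := by positivity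
    have hne : ((T.singularValues k : ℝ) : ℂ) ^ 2 + (η : ℂ) ^ 2 ≠ 0 := by
      exact_mod_cast hpos.ne'
    push_cast
    rw [eq_mul_inv_iff_mul_eq₀ hne]
    simp only [RCLike.conj_ofReal] at h
    push_cast at h
    rw [← hb] at h
    linear_combination h
  have htr : LinearMap.trace ℂ _ L = ∑ k, ((η * (A.singularValue k ^ 2 + η ^ 2)⁻¹ : ℝ) : ℂ) := by
    rw [LinearMap.trace_eq_sum_inner L b]
    exact Finset.sum_congr rfl fun k _ => hinner k
  rw [hL, Matrix.trace_toEuclideanLin] at htr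
  have h := ofReal_resolventMean_eq_inr A hη
  have h2 : ∑ i, skewResolvent η A (.inr i) (.inr i) = (skewResolvent η A).toBlocks₂₂.trace := rfl
  rw [h2, htr, Fintype.card_fin, ← Complex.ofReal_sum, ← Complex.ofReal_natCast,
    ← Complex.ofReal_inv, ← Complex.ofReal_mul] at h
  exact Complex.ofReal_injective h

/-- Integration against the empirical singular value measure. -/
lemma integral_singularValueMeasure (f : ℝ → ℝ) :
    ∫ x, f x ∂(singularValueMeasure A) = (n : ℝ)⁻¹ * ∑ k, f (A.singularValue k) := by
  rw [singularValueMeasure, integral_smul_measure, integral_finsetSum_measure fun k _ =>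
    integrable_dirac (by simp)]
  simp

lemma integrable_singularValueMeasure [NeZero n] (f : ℝ → ℝ) :
    Integrable f (singularValueMeasure A) := by
  rw [singularValueMeasure]
  refine Integrable.smul_measure ?_ (by simp [NeZero.ne n])
  exact integrable_finsetSum_measure.2 fun k _ => integrable_dirac (by simp)

lemma Matrix.singularValue_nonneg (k : Fin n) : 0 ≤ A.singularValue k :=
  LinearMap.singularValues_nonneg _ _

lemma ae_nonneg_singularValueMeasure : ∀ᵐ x ∂(singularValueMeasure A), 0 ≤ x := by
  rw [ae_iff, singularValueMeasure]
  simp only [not_le, Measure.smul_apply, Measure.finsetSum_apply]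
  have h : ∀ k : Fin n, Measure.dirac (A.singularValue k) {a : ℝ | a < 0} = 0 := fun k => by
    have hm : MeasurableSet {a : ℝ | a < 0} := measurableSet_Iio
    rw [Measure.dirac_apply' _ hm]
    simp [A.singularValue_nonneg k]
  simp [h]

end SingularValues

/-! ### Weak convergence on `[0, ∞)` from the test functions `(x² + t)⁻¹` -/

section WeakConvergence

open scoped NNReal BoundedContinuousFunction

/-- The bounded continuous function `x ↦ (x² + t)⁻¹` on `[0, ∞)`, for rational `t > 0`. -/
def invSqAdd (t : Set.Ioi (0 : ℚ)) : ℝ≥0 →ᵇ ℝ :=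
  BoundedContinuousFunction.ofNormedAddCommGroup (fun x : ℝ≥0 => ((x : ℝ) ^ 2 + t)⁻¹)
    (Continuous.inv₀ (by fun_prop) fun x => by
      have : (0 : ℝ) < t := Rat.cast_pos.2 t.2
      positivity)
    ((t : ℝ)⁻¹) fun x => by
      have ht : (0 : ℝ) < t := Rat.cast_pos.2 t.2
      rw [Real.norm_of_nonneg (by positivity)]
      gcongr
      exact le_add_of_nonneg_left (sq_nonneg _)

@[simp]
lemma invSqAdd_apply (t : Set.Ioi (0 : ℚ)) (x : ℝ≥0) : invSqAdd t x = ((x : ℝ) ^ 2 + t)⁻¹ := rfl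

lemma norm_invSqAdd_sub_le (t u : Set.Ioi (0 : ℚ)) :
    ‖invSqAdd u - invSqAdd t‖ ≤ |(t : ℝ) - u| * ((u : ℝ)⁻¹ * (t : ℝ)⁻¹) := by
  have ht : (0 : ℝ) < t := Rat.cast_pos.2 t.2
  have hu : (0 : ℝ) < u := Rat.cast_pos.2 u.2
  refine (BoundedContinuousFunction.norm_le (by positivity)).2 fun x => ?_
  have h : (invSqAdd u - invSqAdd t) x =
      ((t : ℝ) - u) * (((x : ℝ) ^ 2 + u)⁻¹ * ((x : ℝ) ^ 2 + t)⁻¹) := by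
    have h1 : (x : ℝ) ^ 2 + u ≠ 0 := by positivity
    have h2 : (x : ℝ) ^ 2 + t ≠ 0 := by positivity
    simp only [BoundedContinuousFunction.coe_sub, Pi.sub_apply, invSqAdd_apply]
    field_simp
    ring
  rw [h, norm_mul, Real.norm_eq_abs, Real.norm_of_nonneg (by positivity)]
  gcongr <;> exact le_add_of_nonneg_left (sq_nonneg _)

/-- The constant function `1` and the functions `x ↦ (x² + t)⁻¹`. -/
def invSqAddSet : Set (ℝ≥0 →ᵇ ℝ) := insert 1 (Set.range invSqAdd)

lemma invSqAdd_mem_span (t : Set.Ioi (0 : ℚ)) : invSqAdd t ∈ Submodule.span ℝ invSqAddSet :=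
  Submodule.subset_span (Set.mem_insert_of_mem _ ⟨t, rfl⟩)

/-- Partial fractions. -/
lemma invSqAdd_mul_mem_span {t u : Set.Ioi (0 : ℚ)} (h : t ≠ u) :
    invSqAdd t * invSqAdd u ∈ Submodule.span ℝ invSqAddSet := by
  have ht : (0 : ℝ) < t := Rat.cast_pos.2 t.2
  have hu : (0 : ℝ) < u := Rat.cast_pos.2 u.2
  have hne : (u : ℝ) - t ≠ 0 := sub_ne_zero.2 fun h' => h (Subtype.ext (Rat.cast_injective h'.symm))
  have key : invSqAdd t * invSqAdd u = ((u : ℝ) - t)⁻¹ • (invSqAdd t - invSqAdd u) := by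
    ext x
    have h1 : (x : ℝ) ^ 2 + u ≠ 0 := by positivity
    have h2 : (x : ℝ) ^ 2 + t ≠ 0 := by positivity
    simp only [BoundedContinuousFunction.coe_mul, Pi.mul_apply, invSqAdd_apply,
      BoundedContinuousFunction.coe_smul, BoundedContinuousFunction.coe_sub, Pi.sub_apply,
      smul_eq_mul]
    field_simp
    ring
  rw [key]
  exact Submodule.smul_mem _ _ (Submodule.sub_mem _ (invSqAdd_mem_span t) (invSqAdd_mem_span u))

/-- On the diagonal `t = u` partial fractions fail, and the product is a uniform limit of products
with distinct parameters `t` and `t + 1 / (k + 1)`. -/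
lemma invSqAdd_mul_mem_closure (t u : Set.Ioi (0 : ℚ)) :
    invSqAdd t * invSqAdd u ∈ closure (Submodule.span ℝ invSqAddSet : Set (ℝ≥0 →ᵇ ℝ)) := by
  by_cases h : t = u
  · subst h
    have ht : (0 : ℝ) < t := Rat.cast_pos.2 t.2
    let v : ℕ → Set.Ioi (0 : ℚ) := fun k => ⟨t + 1 / ((k : ℚ) + 1), by
      have : (0 : ℚ) < t := t.2
      rw [Set.mem_Ioi]; positivity⟩
    have hv : ∀ k, (v k : ℝ) = t + 1 / ((k : ℝ) + 1) := fun k => by simp [v]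
    have hlim : Tendsto (fun k => invSqAdd (v k)) atTop (𝓝 (invSqAdd t)) := by
      rw [tendsto_iff_norm_sub_tendsto_zero]
      have h0 : Tendsto (fun k : ℕ => 1 / ((k : ℝ) + 1) * ((t : ℝ)⁻¹ * (t : ℝ)⁻¹)) atTop (𝓝 0) := by
        simpa using tendsto_one_div_add_atTop_nhds_zero_nat.mul_const ((t : ℝ)⁻¹ * (t : ℝ)⁻¹)
      refine squeeze_zero (fun _ => norm_nonneg _) (fun k => ?_) h0
      refine (norm_invSqAdd_sub_le t (v k)).trans ?_
      have hk : (0 : ℝ) < 1 / ((k : ℝ) + 1) := by positivity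
      rw [hv, sub_add_cancel_left, abs_neg, abs_of_pos hk]
      gcongr
      linarith
    refine mem_closure_of_tendsto (hlim.const_mul (invSqAdd t)) (.of_forall fun k => ?_)
    refine invSqAdd_mul_mem_span fun h' => ?_
    have h2 : (t : ℝ) = (v k : ℝ) := by rw [← h']
    rw [hv] at h2
    have hk : (0 : ℝ) < 1 / ((k : ℝ) + 1) := by positivity
    linarith
  · exact subset_closure (invSqAdd_mul_mem_span h)

/-- Products of generators lie in the closure, and continuity of multiplication extends this. Hence
the linear span is already dense in the algebra it generates, and convergence of integrals need only
be checked on generators. -/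
lemma mul_mem_closure_span_invSqAddSet {f g : ℝ≥0 →ᵇ ℝ}
    (hf : f ∈ closure (Submodule.span ℝ invSqAddSet : Set (ℝ≥0 →ᵇ ℝ)))
    (hg : g ∈ closure (Submodule.span ℝ invSqAddSet : Set (ℝ≥0 →ᵇ ℝ))) :
    f * g ∈ closure (Submodule.span ℝ invSqAddSet : Set (ℝ≥0 →ᵇ ℝ)) := by
  have hle : Submodule.span ℝ invSqAddSet * Submodule.span ℝ invSqAddSet ≤
      (Submodule.span ℝ invSqAddSet).topologicalClosure := by
    rw [Submodule.span_mul_span, Submodule.span_le]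
    rintro _ ⟨a, ha, b, hb, rfl⟩
    change a * b ∈ closure (Submodule.span ℝ invSqAddSet : Set (ℝ≥0 →ᵇ ℝ))
    rcases ha with rfl | ⟨t, rfl⟩
    · rw [one_mul]; exact subset_closure (Submodule.subset_span hb)
    · rcases hb with rfl | ⟨u, rfl⟩
      · rw [mul_one]; exact subset_closure (invSqAdd_mem_span t)
      · exact invSqAdd_mul_mem_closure t u
  rw [← closure_closure]
  exact map_mem_closure₂ continuous_mul hf hg fun a ha b hb => hle (Submodule.mul_mem_mul ha hb)

/-- The star algebra generated by the functions `x ↦ (x² + t)⁻¹`. -/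
def invSqAddAlgebra : StarSubalgebra ℝ (ℝ≥0 →ᵇ ℝ) := StarAlgebra.adjoin ℝ (Set.range invSqAdd)

lemma mem_closure_of_mem_invSqAddAlgebra {f : ℝ≥0 →ᵇ ℝ} (hf : f ∈ invSqAddAlgebra) :
    f ∈ closure (Submodule.span ℝ invSqAddSet : Set (ℝ≥0 →ᵇ ℝ)) := by
  induction hf using StarAlgebra.adjoin_induction with
  | mem x hx => exact subset_closure (Submodule.subset_span (Set.mem_insert_of_mem _ hx))
  | algebraMap r =>
    refine subset_closure ?_
    rw [Algebra.algebraMap_eq_smul_one]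
    exact Submodule.smul_mem _ _ (Submodule.subset_span (Set.mem_insert _ _))
  | add x y _ _ hx hy => exact (Submodule.span ℝ invSqAddSet).topologicalClosure.add_mem hx hy
  | mul x y _ _ hx hy => exact mul_mem_closure_span_invSqAddSet hx hy
  | star x _ hx =>
    have : star x = x := by ext; simp
    rwa [this]

/-- Squaring is injective on `ℝ≥0` but not on `ℝ`; for this reason the measures are transported to
`ℝ≥0`. -/
lemma separatesPoints_invSqAddAlgebra :
    (invSqAddAlgebra.map (BoundedContinuousFunction.toContinuousMapStarₐ ℝ)).SeparatesPoints := by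
  intro x y hxy
  let t : Set.Ioi (0 : ℚ) := ⟨1, by simp⟩
  refine ⟨invSqAdd t, ⟨(invSqAdd t).toContinuousMap, ?_, rfl⟩, fun h => hxy ?_⟩
  · exact ⟨invSqAdd t, StarAlgebra.subset_adjoin _ _ ⟨t, rfl⟩, rfl⟩
  · have h1 : invSqAdd t x = invSqAdd t y := h
    have h2 : (x : ℝ) ^ 2 = (y : ℝ) ^ 2 := by simpa [t, invSqAdd_apply] using h1
    exact NNReal.coe_injective ((sq_eq_sq₀ x.2 y.2).1 h2)

/-- Convergence of integrals is preserved under uniform limits of the test function. -/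
lemma tendsto_integral_of_mem_closure {μ : ℕ → ProbabilityMeasure ℝ≥0}
    {μ₀ : ProbabilityMeasure ℝ≥0} {s : Set (ℝ≥0 →ᵇ ℝ)}
    (h : ∀ f ∈ s, Tendsto (fun n => ∫ x, f x ∂(μ n : Measure ℝ≥0)) atTop
      (𝓝 (∫ x, f x ∂(μ₀ : Measure ℝ≥0))))
    {g : ℝ≥0 →ᵇ ℝ} (hg : g ∈ closure s) :
    Tendsto (fun n => ∫ x, g x ∂(μ n : Measure ℝ≥0)) atTop
      (𝓝 (∫ x, g x ∂(μ₀ : Measure ℝ≥0))) := by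
  have hdist : ∀ (ν : ProbabilityMeasure ℝ≥0) (f : ℝ≥0 →ᵇ ℝ),
      |(∫ x, g x ∂(ν : Measure ℝ≥0)) - ∫ x, f x ∂(ν : Measure ℝ≥0)| ≤ dist g f := fun ν f => by
    rw [← integral_sub (g.integrable _) (f.integrable _)]
    have := norm_integral_le_of_norm_le_const (μ := (ν : Measure ℝ≥0)) (C := dist g f)
      (f := fun x => g x - f x) (.of_forall fun x => by
        rw [← dist_eq_norm]; exact BoundedContinuousFunction.dist_coe_le_dist x)
    simpa using this
  rw [Metric.tendsto_atTop']
  intro ε hε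
  obtain ⟨f, hf, hgf⟩ := Metric.mem_closure_iff.1 hg (ε / 3) (by positivity)
  obtain ⟨N, hN⟩ := Metric.tendsto_atTop'.1 (h f hf) (ε / 3) (by positivity)
  refine ⟨N, fun n hn => ?_⟩
  have h1 := hdist (μ n) f
  have h2 := hdist μ₀ f
  have h3 := hN n hn
  rw [Real.dist_eq] at h3 ⊢
  rw [abs_lt] at h3 ⊢
  rw [abs_le] at h1 h2
  constructor <;> linarith [h1.1, h1.2, h2.1, h2.2, h3.1, h3.2]

/-- A tight sequence of probability measures on `[0, ∞)` converges weakly if the integrals of the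
functions `x ↦ (x² + t)⁻¹` converge. -/
lemma tendsto_of_forall_tendsto_integral_invSqAdd {μ : ℕ → ProbabilityMeasure ℝ≥0}
    (hμ : IsTightMeasureSet {(μ n : Measure ℝ≥0) | n}) {μ₀ : ProbabilityMeasure ℝ≥0}
    (h : ∀ t, Tendsto (fun n => ∫ x, invSqAdd t x ∂(μ n : Measure ℝ≥0)) atTop
      (𝓝 (∫ x, invSqAdd t x ∂(μ₀ : Measure ℝ≥0)))) :
    Tendsto μ atTop (𝓝 μ₀) := by
  refine ProbabilityMeasure.tendsto_of_tight_of_separatesPoints ℝ hμ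
    separatesPoints_invSqAddAlgebra fun g hg =>
      tendsto_integral_of_mem_closure (fun f hf => ?_) (mem_closure_of_mem_invSqAddAlgebra hg)
  induction hf using Submodule.span_induction with
  | mem f hf =>
    rcases hf with rfl | ⟨t, rfl⟩
    · simp
    · exact h t
  | zero => simp
  | add f g _ _ hf hg =>
    simp only [BoundedContinuousFunction.coe_add, Pi.add_apply]
    simp only [fun ν : ProbabilityMeasure ℝ≥0 =>
      integral_add (f.integrable (ν : Measure ℝ≥0)) (g.integrable (ν : Measure ℝ≥0))]
    exact hf.add hg
  | smul r f _ hf =>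
    simp only [BoundedContinuousFunction.coe_smul, smul_eq_mul, integral_const_mul]
    exact hf.const_mul r

/-- The limits of the integrals of `x ↦ (x² + t)⁻¹` along a tight sequence are the integrals
against a probability measure. -/
lemma exists_integral_invSqAdd_eq {μ : ℕ → ProbabilityMeasure ℝ≥0}
    (hμ : IsTightMeasureSet {(μ n : Measure ℝ≥0) | n}) {G : Set.Ioi (0 : ℚ) → ℝ}
    (h : ∀ t, Tendsto (fun n => ∫ x, invSqAdd t x ∂(μ n : Measure ℝ≥0)) atTop (𝓝 (G t))) :
    ∃ μ₀ : ProbabilityMeasure ℝ≥0, ∀ t, ∫ x, invSqAdd t x ∂(μ₀ : Measure ℝ≥0) = G t := by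
  have hc : IsCompact (closure {μ n | n}) :=
    isCompact_closure_of_isTightMeasureSet (by simpa using hμ)
  -- Prokhorov's theorem gives a limit along an ultrafilter finer than `atTop`, where the assumed
  -- limits `G t` persist.
  obtain ⟨μ₀, -, hμ₀ : Tendsto _ _ _⟩ := hc.ultrafilter_le_nhds ((hyperfilter ℕ).map μ)
    (.trans (by simp) (monotone_principal subset_closure))
  refine ⟨μ₀, fun t => ?_⟩
  rw [ProbabilityMeasure.tendsto_iff_forall_integral_tendsto] at hμ₀
  exact tendsto_nhds_unique (hμ₀ (invSqAdd t)) ((h t).mono_left Nat.hyperfilter_le_atTop)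

/-- Tightness from bounded second moments. -/
lemma isTightMeasureSet_of_integral_sq_le {μ : ℕ → ProbabilityMeasure ℝ≥0} {C : ℝ}
    (hi : ∀ n, Integrable (fun x : ℝ≥0 => (x : ℝ) ^ 2) (μ n : Measure ℝ≥0))
    (hC : ∀ n, ∫ x, (x : ℝ) ^ 2 ∂(μ n : Measure ℝ≥0) ≤ C) :
    IsTightMeasureSet {(μ n : Measure ℝ≥0) | n} := by
  rw [isTightMeasureSet_iff_exists_isCompact_measure_compl_le]
  intro ε hε
  have hC0 : 0 ≤ C := (integral_nonneg fun x => sq_nonneg _).trans (hC 0)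
  obtain ⟨r, hr0, hr⟩ : ∃ r : ℝ, 0 < r ∧ ENNReal.ofReal r ≤ ε := by
    rcases eq_or_ne ε ⊤ with rfl | h
    · exact ⟨1, one_pos, le_top⟩
    · exact ⟨ε.toReal, ENNReal.toReal_pos hε.ne' h, by rw [ENNReal.ofReal_toReal h]⟩
  -- By Markov's inequality the mass beyond `R` is at most `C / R² = r C / (C + 1) ≤ r`; `C + 1`
  -- covers `C = 0`.
  let R : ℝ≥0 := ⟨√((C + 1) / r), Real.sqrt_nonneg _⟩
  have hR : (R : ℝ) ^ 2 = (C + 1) / r := Real.sq_sqrt (by positivity)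
  refine ⟨Set.Icc 0 R, isCompact_Icc, ?_⟩
  rintro _ ⟨n, rfl⟩
  have h1 := mul_meas_ge_le_integral_of_nonneg (μ := (μ n : Measure ℝ≥0))
    (.of_forall fun x : ℝ≥0 => sq_nonneg (x : ℝ)) (hi n) ((C + 1) / r)
  have hsub : (Set.Icc 0 R)ᶜ ⊆ {x : ℝ≥0 | (C + 1) / r ≤ (x : ℝ) ^ 2} := fun x hx => by
    have hx' : R < x := by simpa using hx
    rw [Set.mem_ofPred_eq, ← hR]
    exact pow_le_pow_left₀ R.2 (by exact_mod_cast hx'.le) 2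
  refine (measure_mono hsub).trans (le_trans ?_ hr)
  rw [← ofReal_measureReal]
  refine ENNReal.ofReal_le_ofReal ?_
  have h2 := h1.trans (hC n)
  rw [div_mul_eq_mul_div, div_le_iff₀ hr0] at h2
  have h3 : 0 ≤ (μ n : Measure ℝ≥0).real {x : ℝ≥0 | (C + 1) / r ≤ (x : ℝ) ^ 2} :=
    measureReal_nonneg
  by_contra! hcon
  nlinarith

end WeakConvergence

/-! ### Tightness, existence of the limit law and conclusion -/

section Main

open scoped NNReal

variable {n : ℕ} [NeZero n] (A : Matrix (Fin n) (Fin n) ℂ)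

/-- The empirical singular value measure as a probability measure on `ℝ≥0`. -/
def singularValueProbNNReal : ProbabilityMeasure ℝ≥0 :=
  (singularValueProb A).map (f := Real.toNNReal) measurable_real_toNNReal.aemeasurable

lemma map_coe_singularValueProbNNReal :
    (singularValueProbNNReal A).map NNReal.continuous_coe.measurable.aemeasurable =
      singularValueProb A := by
  apply Subtype.ext
  change ((singularValueMeasure A).map Real.toNNReal).map ((↑) : ℝ≥0 → ℝ) = singularValueMeasure A
  rw [Measure.map_map NNReal.continuous_coe.measurable measurable_real_toNNReal]
  have h : ((↑) : ℝ≥0 → ℝ) ∘ Real.toNNReal =ᵐ[singularValueMeasure A] id := by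
    filter_upwards [ae_nonneg_singularValueMeasure A] with x hx
    simp [hx]
  rw [Measure.map_congr h, Measure.map_id]

lemma integral_singularValueProbNNReal {f : ℝ → ℝ} (hf : Measurable f) :
    ∫ x, f x ∂(singularValueProbNNReal A : Measure ℝ≥0) =
      (n : ℝ)⁻¹ * ∑ k, f (A.singularValue k) := by
  change ∫ x : ℝ≥0, f x ∂((singularValueMeasure A).map Real.toNNReal) = _
  have hf' : Measurable fun x : ℝ≥0 => f x := hf.comp measurable_coe_nnreal_real
  rw [integral_map measurable_real_toNNReal.aemeasurable hf'.aestronglyMeasurable,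
    integral_singularValueMeasure]
  simp [A.singularValue_nonneg]

lemma integral_invSqAdd_singularValueProbNNReal (t : Set.Ioi (0 : ℚ)) :
    ∫ x, invSqAdd t x ∂(singularValueProbNNReal A : Measure ℝ≥0) =
      (√(t : ℝ))⁻¹ * resolventMean (√(t : ℝ)) A := by
  have ht : (0 : ℝ) < t := Rat.cast_pos.2 t.2
  have hs : 0 < √(t : ℝ) := Real.sqrt_pos.2 ht
  simp only [invSqAdd_apply]
  rw [integral_singularValueProbNNReal A (f := fun x => (x ^ 2 + (t : ℝ))⁻¹) (by fun_prop),
    resolventMean_eq_sum_singularValue A hs, Real.sq_sqrt ht.le, ← Finset.mul_sum]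
  field_simp

lemma integrable_sq_singularValueProbNNReal :
    Integrable (fun x : ℝ≥0 => (x : ℝ) ^ 2) (singularValueProbNNReal A : Measure ℝ≥0) := by
  change Integrable _ ((singularValueMeasure A).map Real.toNNReal)
  rw [integrable_map_measure (Measurable.aestronglyMeasurable (by fun_prop))
    measurable_real_toNNReal.aemeasurable]
  exact integrable_singularValueMeasure A _

lemma integral_sq_singularValueProbNNReal :
    ∫ x, (x : ℝ) ^ 2 ∂(singularValueProbNNReal A : Measure ℝ≥0) =
      (n : ℝ)⁻¹ * ∑ i, ∑ j, ‖A i j‖ ^ 2 := by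
  rw [integral_singularValueProbNNReal A (f := fun x => x ^ 2) (by fun_prop),
    Matrix.sum_sq_singularValue]

/-- The second moment of the empirical singular value measure of a shifted matrix. -/
lemma integral_sq_shiftedMatrix_le {Ω : Type*} (X : ℕ → ℕ → Ω → ℂ) (z : ℂ) (ω : Ω) :
    ∫ x, (x : ℝ) ^ 2 ∂(singularValueProbNNReal (shiftedMatrix X z n ω) : Measure ℝ≥0) ≤
      2 * ((∑ i : Fin n, ∑ j : Fin n, ‖X i j ω‖ ^ 2) / (n : ℝ) ^ 2) + 2 * ‖z‖ ^ 2 := by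
  have hn0 : (0 : ℝ) < n := by exact_mod_cast Nat.pos_of_ne_zero (NeZero.ne n)
  rw [integral_sq_singularValueProbNNReal]
  have h : ∀ i j : Fin n, ‖shiftedMatrix X z n ω i j‖ ^ 2 ≤
      2 * ((n : ℝ)⁻¹ * ‖X i j ω‖ ^ 2) + 2 * (if i = j then ‖z‖ ^ 2 else 0) := fun i j => by
    have h1 : shiftedMatrix X z n ω i j =
        ((√n : ℝ) : ℂ)⁻¹ * X i j ω - (if i = j then z else 0) := by
      simp [shiftedMatrix, cornerMatrix, Matrix.one_apply]
    have h2 : ‖((√n : ℝ) : ℂ)⁻¹ * X i j ω‖ ^ 2 = (n : ℝ)⁻¹ * ‖X i j ω‖ ^ 2 := by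
      rw [norm_mul, norm_inv_sqrt_natCast, mul_pow, inv_pow, Real.sq_sqrt hn0.le]
    have h3 : ‖(if i = j then z else 0 : ℂ)‖ ^ 2 = if i = j then ‖z‖ ^ 2 else 0 := by
      split_ifs <;> simp
    rw [h1, ← h2, ← h3]
    have h4 := pow_le_pow_left₀ (norm_nonneg _)
      (norm_sub_le (((√n : ℝ) : ℂ)⁻¹ * X i j ω) (if i = j then z else 0)) 2
    nlinarith [sq_nonneg (‖((√n : ℝ) : ℂ)⁻¹ * X i j ω‖ - ‖(if i = j then z else 0 : ℂ)‖)]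
  calc _ ≤ (n : ℝ)⁻¹ * ∑ i : Fin n, ∑ j : Fin n,
        (2 * ((n : ℝ)⁻¹ * ‖X i j ω‖ ^ 2) + 2 * (if i = j then ‖z‖ ^ 2 else 0)) := by
        gcongr with i _ j _
        exact h i j
    _ = _ := by
        simp only [Finset.sum_add_distrib, ← Finset.mul_sum, Finset.sum_ite_eq, Finset.mem_univ,
          if_true, Finset.sum_const, Finset.card_univ, Fintype.card_fin, nsmul_eq_mul]
        field_simp

namespace IsIIDTableVarOne

variable {Ω : Type*} [MeasurableSpace Ω] {P : Measure Ω} {X : ℕ → ℕ → Ω → ℂ}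

/-- The empirical singular value measures are almost surely tight. -/
lemma ae_isTightMeasureSet (hX : IsIIDTableVarOne P X) (z : ℂ) :
    ∀ᵐ ω ∂P, IsTightMeasureSet
      {(singularValueProbNNReal (shiftedMatrix X z (n + 1) ω) : Measure ℝ≥0) | n} := by
  -- The law of large numbers for `|X|²` bounds the normalized Frobenius norms, hence the second
  -- moments, along almost every sample.
  have h := hX.ae_tendsto_average (g := fun x => ‖x‖ ^ 2) (by fun_prop)
    (hX.memLp.integrable_norm_pow (by norm_num))
  filter_upwards [h] with ω hω
  obtain ⟨C, hC⟩ := hω.bddAbove_range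
  refine isTightMeasureSet_of_integral_sq_le (C := 2 * C + 2 * ‖z‖ ^ 2)
    (fun n => integrable_sq_singularValueProbNNReal _) fun n => ?_
  refine (integral_sq_shiftedMatrix_le X z ω).trans ?_
  have := hC ⟨n + 1, rfl⟩
  gcongr

/-- Convergence of the integrals of `x ↦ (x² + t)⁻¹`. -/
lemma ae_tendsto_integral_invSqAdd [IsProbabilityMeasure P] (hX : IsIIDTableVarOne P X) (z : ℂ) :
    ∀ᵐ ω ∂P, ∀ t, Tendsto (fun n : ℕ => ∫ x, invSqAdd t x
        ∂(singularValueProbNNReal (shiftedMatrix X z (n + 1) ω) : Measure ℝ≥0)) atTop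
      (𝓝 ((√(t : ℝ))⁻¹ * limitMean z (√(t : ℝ)))) := by
  refine ae_all_iff.2 fun t => ?_
  have hs : 0 < √(t : ℝ) := Real.sqrt_pos.2 (Rat.cast_pos.2 t.2)
  filter_upwards [hX.ae_tendsto_resolventMean hs z] with ω hω
  simp only [integral_invSqAdd_singularValueProbNNReal]
  exact hω.const_mul _

end IsIIDTableVarOne

/-- The symmetric Bernoulli law on `{1, -1}`. -/
def rademacherMeasure : Measure ℂ :=
  (2 : ENNReal)⁻¹ • Measure.dirac 1 + (2 : ENNReal)⁻¹ • Measure.dirac (-1)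

instance : IsProbabilityMeasure rademacherMeasure := by
  constructor
  simp [rademacherMeasure, ENNReal.inv_two_add_inv_two]

lemma integral_rademacherMeasure {E : Type*} [NormedAddCommGroup E] [NormedSpace ℝ E]
    [CompleteSpace E] (f : ℂ → E) :
    ∫ x, f x ∂rademacherMeasure = (2 : ℝ)⁻¹ • f 1 + (2 : ℝ)⁻¹ • f (-1) := by
  have h : ∀ a : ℂ, Integrable f ((2 : ENNReal)⁻¹ • Measure.dirac a) := fun a =>
    (integrable_dirac (by simp)).smul_measure (by simp)
  rw [rademacherMeasure, integral_add_measure (h _) (h _), integral_smul_measure,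
    integral_smul_measure]
  simp

/-- Tables of i.i.d. random variables of unit variance exist. -/
lemma exists_isIIDTableVarOne :
    ∃ (Ω : Type) (_ : MeasurableSpace Ω) (P : Measure Ω) (X : ℕ → ℕ → Ω → ℂ),
      IsProbabilityMeasure P ∧ IsIIDTableVarOne P X := by
  obtain ⟨Ω, mΩ, P, X, hXm, hlaw, hind, hP⟩ := exists_iid (ℕ × ℕ) rademacherMeasure
  have hL2 : MemLp (id : ℂ → ℂ) 2 rademacherMeasure := by
    refine .of_bound measurable_id.aestronglyMeasurable 1 ?_
    have hae : ∀ a : ℂ, ‖a‖ ≤ 1 → ∀ᵐ x ∂(Measure.dirac a), ‖id x‖ ≤ 1 := fun a ha => by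
      rw [ae_dirac_eq]; exact ha
    rw [rademacherMeasure, ae_add_measure_iff]
    exact ⟨Measure.ae_smul_measure (hae 1 (by simp)) _,
      Measure.ae_smul_measure (hae (-1) (by simp)) _⟩
  have hInt : ∀ {E : Type} [NormedAddCommGroup E] [NormedSpace ℝ E] [CompleteSpace E]
      (f : ℂ → E), AEStronglyMeasurable f rademacherMeasure →
      ∫ ω, f (X (0, 0) ω) ∂P = (2 : ℝ)⁻¹ • f 1 + (2 : ℝ)⁻¹ • f (-1) := by
    intro E _ _ _ f hf
    rw [← integral_rademacherMeasure, ← (hlaw (0, 0)).map_eq,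
      integral_map (hXm _).aemeasurable (by rwa [(hlaw (0, 0)).map_eq])]
  refine ⟨Ω, mΩ, P, fun i j => X (i, j), hP, fun i j => hXm _, hind, fun i j => ?_, ?_, ?_⟩
  · exact ⟨(hXm _).aemeasurable, (hXm _).aemeasurable, by
      rw [(hlaw _).map_eq, (hlaw _).map_eq]⟩
  · rw [← (hlaw (0, 0)).map_eq] at hL2
    exact (memLp_map_measure_iff measurable_id.aestronglyMeasurable (hXm _).aemeasurable).1 hL2
  · rw [hInt (fun x => ‖x‖ ^ 2) (Measurable.aestronglyMeasurable (by fun_prop)),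
      hInt (fun x => x) measurable_id.aestronglyMeasurable]
    norm_num

/-- The limiting measure, on `ℝ≥0`. -/
lemma exists_limit_measure (z : ℂ) :
    ∃ μ : ProbabilityMeasure ℝ≥0, ∀ t : Set.Ioi (0 : ℚ),
      ∫ x, invSqAdd t x ∂(μ : Measure ℝ≥0) = (√(t : ℝ))⁻¹ * limitMean z (√(t : ℝ)) := by
  -- The prescribed integrals depend on `z` alone, so a single good sample point of any one table
  -- produces the measure.
  obtain ⟨Ω, mΩ, P, X, hP, hX⟩ := exists_isIIDTableVarOne
  obtain ⟨ω, h1, h2⟩ :=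
    ((hX.ae_isTightMeasureSet z).and (hX.ae_tendsto_integral_invSqAdd z)).exists
  exact exists_integral_invSqAdd_eq h1 h2

end Main

end

theorem mainTheorem6 (z : ℂ) :
    ∃ ν : ProbabilityMeasure ℝ, (ν : Measure ℝ) (Set.Iio 0) = 0 ∧
      ∀ (Ω : Type*) [MeasurableSpace Ω] (P : Measure Ω) [IsProbabilityMeasure P]
        (X : ℕ → ℕ → Ω → ℂ), IsIIDTableVarOne P X →
        ∀ᵐ ω ∂P, Tendsto (fun n : ℕ => singularValueProb (shiftedMatrix X z (n + 1) ω))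
          atTop (𝓝 ν) := by
  obtain ⟨μ, hμ⟩ := exists_limit_measure z
  refine ⟨μ.map NNReal.continuous_coe.measurable.aemeasurable, ?_, ?_⟩
  · rw [ProbabilityMeasure.toMeasure_map,
      Measure.map_apply NNReal.continuous_coe.measurable measurableSet_Iio]
    have : ((↑) : NNReal → ℝ) ⁻¹' Set.Iio 0 = ∅ := by
      ext x; simp
    rw [this, measure_empty]
  · intro Ω _ P _ X hX
    filter_upwards [hX.ae_isTightMeasureSet z, hX.ae_tendsto_integral_invSqAdd z] with ω h1 h2
    have h3 : Tendsto (fun n : ℕ => singularValueProbNNReal (shiftedMatrix X z (n + 1) ω)) atTop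
        (𝓝 μ) :=
      -- The integrals converge to values given by `limitMean`, which `hμ` identifies with those of
      -- `μ` whatever the law of the table.
      tendsto_of_forall_tendsto_integral_invSqAdd h1 fun t => by rw [hμ]; exact h2 t
    have h4 := ProbabilityMeasure.tendsto_map_of_tendsto_of_continuous _ _ h3
      NNReal.continuous_coe
    simpa only [map_coe_singularValueProbNNReal] using h4
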